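/- Given graphs $G$ and $F$, a spanning subgraph $H$ of $G$ is called $F$-saturated relative to $G$ if $H$ contains no copy of $F$, but the addition to $H$ of any edge of $E(G)\setminus E(H)$ creates a copy of $F$. Let $\mathrm{sat}(G,F)$ denote the minimum number of edges of an $F$-saturated subgraph relative to $G$. Let $K_k^n$ be the complete $k$-partite graph with $n$ vertices in each part, and let $C_4$ be the cycle of length $4$. Theorem. For all integers $k \ge 5$ and $n \ge 1$, $$\mathrm{sat}(K_k^n, C_4) = \left\lfloor \frac{3(k-1)n-2}{2} \right\rfloor = \begin{cases} \frac32 (k-1)n - \frac32, & \text{if } k \text{ is even and } n \text{ is odd},\\ \frac32 (k-1)n - 1, & \text{otherwise.}\end{cases}$$ Moreover, for every integer $n \ge 1$, $$\left\lfloor \tfrac92 n - 1 \right\rfloor \le \mathrm{sat}(K_4^n, C_4) \le 5n-1.$$ -/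

import Mathlib

/-- `H` is `F`-saturated relative to `G`: `H` is a subgraph of `G` (on the same vertex set) that
contains no copy of `F`, but adding to `H` any edge `uv` of `E(G) \ E(H)` creates a copy of `F`. -/
def IsSaturatedRel {V W : Type*} (G : SimpleGraph V) (F : SimpleGraph W)
    (H : SimpleGraph V) : Prop :=
  H ≤ G ∧ ¬ F.IsContained H ∧
    ∀ u v : V, G.Adj u v → ¬ H.Adj u v → F.IsContained (H ⊔ SimpleGraph.edge u v)

/-- The saturation number `sat(G, F)`: the least number of edges of a graph that is `F`-saturated
relative to `G`. The infimum is in `ℕ`, so a positive value is attained by such a graph. -/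
noncomputable def satNumber {V W : Type*} (G : SimpleGraph V) (F : SimpleGraph W) : ℕ :=
  sInf {m : ℕ | ∃ H : SimpleGraph V, IsSaturatedRel G F H ∧ H.edgeSet.ncard = m}

/-- `sat(K_k^n, C_l)`, where `K_k^n` is the complete `k`-partite graph with `n` vertices in each
part and `C_l` is the cycle on `l` vertices (a genuine cycle for `3 ≤ l`). -/
noncomputable def satPartiteCycle (k n l : ℕ) : ℕ :=
  satNumber (SimpleGraph.completeEquipartiteGraph k n) (SimpleGraph.cycleGraph l)

/-!
A subgraph `H` of the complete multipartite graph is `C₄`-saturated exactly if two vertices have at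
most one common neighbour and nonadjacent vertices from different parts are joined by a path of
length three (`isSaturatedRel_cycleGraph_four_iff`). Everything below uses only these two
properties. With `N = kn` vertices, the value to be proved amounts to degree sum at least `3N - 3n
- 3` and to constructions that attain it up to parity.

Lower bound, with a leaf `u` at `x`. Every vertex other than `x` outside the part `P` of `u` is
reached from `u` in three steps, so it has a neighbour in `N(x)`, and by the first property only
one. Adding up degrees according to the number of neighbours in `N(x)`, each vertex contributes at
least `3`, except that vertices of `P` may contribute less, which is what the term `3n` allows for,
and leaves outside `P` contribute `2`. The latter are few: leaves in different parts hang from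
adjacent vertices, and a `C₄`-free graph has no large complete multipartite subgraphs, so at most
three parts contain leaves, and if there are three then the leaves hang from a triangle, all those
in one part from the same vertex (`IsC4Saturated.exists_leaf`,
`IsC4Saturated.three_mul_card_le_of_leaf`).

Lower bound, without leaves. If there is no vertex of degree two, the degree sum is at least `3N`.
Otherwise let `v` have the two neighbours `a` and `b`, and sort the vertices by their distance to
`v`. At distances two and three the average contribution is `3` except for deficient vertices at
distance two, whose only neighbours besides `a` or `b` are children of degree two (`IsDeficient`).
Deficient vertices in different parts must be joined by an edge between their children (`IsLink`),
and these edges are so restrictive that there are at most `2n` deficient vertices, and fewer if `a`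
and `b` are not adjacent (`IsC4Saturated.card_deficient_le_of_adj`,
`IsC4Saturated.card_deficient_lt_of_not_adj`). Vertices further away lie in the part of `v`. The
count is `IsC4Saturated.three_mul_card_le_of_degree_eq_two`.

Upper bound. Take a triangle of three hubs and attach every other vertex to a hub, either as a leaf
or as part of a triangle (`hubGraph`). This is saturated if the leaves at each hub lie in one part,
and each leaf saves half an edge. For `k ≥ 5` there is room for `3n - 1` leaves, and for `3n` if
`k` is even and `n` is odd; for `k = 4` the construction has `2n - 1` leaves. The remaining
vertices are matched across the parts, which is possible because no part makes up more than half of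
them (`exists_involution_of_balanced`).
-/

open Finset

/-! ### Four-cycles and saturation -/

/-- A copy of `C₄` is a closed walk `a b c d` whose opposite vertices differ. -/
theorem cycleGraph_four_isContained_iff {V : Type*} (H : SimpleGraph V) :
    (SimpleGraph.cycleGraph 4).IsContained H ↔
      ∃ a b c d : V, a ≠ c ∧ b ≠ d ∧ H.Adj a b ∧ H.Adj b c ∧ H.Adj c d ∧ H.Adj d a := by
  constructor
  · rintro ⟨φ⟩
    refine ⟨φ 0, φ 1, φ 2, φ 3, fun h => ?_, fun h => ?_, ?_, ?_, ?_, ?_⟩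
    · exact absurd (φ.injective h) (by decide)
    · exact absurd (φ.injective h) (by decide)
    all_goals exact φ.toHom.map_adj (by decide)
  · rintro ⟨a, b, c, d, hac, hbd, hab, hbc, hcd, hda⟩
    refine ⟨⟨⟨![a, b, c, d], ?_⟩, ?_⟩⟩
    · intro i j hij
      fin_cases i <;> fin_cases j <;> first
        | (exfalso; revert hij; decide)
        | simp [hab, hbc, hcd, hda, hab.symm, hbc.symm, hcd.symm, hda.symm]
    · have := hab.ne
      have := hbc.ne
      have := hcd.ne
      have := hda.ne
      intro i j hij
      fin_cases i <;> fin_cases j <;> simp_all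

/-- `H` is `C₄`-saturated relative to the complete multipartite graph whose parts are the fibres of
`p`, spelled out by adjacency: the fibres are independent, nonadjacent vertices in different fibres
are joined by a path of length three, and distinct vertices have at most one common neighbour.
In `join` the four vertices are automatically distinct. -/
structure IsC4Saturated {V ι : Type*} (H : SimpleGraph V) (p : V → ι) : Prop where
  proper : ∀ ⦃u v⦄, H.Adj u v → p u ≠ p v
  join : ∀ ⦃u v⦄, p u ≠ p v → ¬ H.Adj u v → ∃ x y, H.Adj u x ∧ H.Adj x y ∧ H.Adj y v
  unique : ∀ ⦃a c⦄, a ≠ c → ∀ ⦃b d⦄, H.Adj a b → H.Adj c b → H.Adj a d → H.Adj c d → b = d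

theorem isSaturatedRel_cycleGraph_four_iff {V ι : Type*} (G H : SimpleGraph V) (p : V → ι)
    (hG : ∀ u v, G.Adj u v ↔ p u ≠ p v) :
    IsSaturatedRel G (SimpleGraph.cycleGraph 4) H ↔ IsC4Saturated H p := by
  have hfree : ¬ (SimpleGraph.cycleGraph 4).IsContained H ↔
      ∀ ⦃a c⦄, a ≠ c → ∀ ⦃b d⦄, H.Adj a b → H.Adj c b → H.Adj a d → H.Adj c d → b = d := by
    rw [cycleGraph_four_isContained_iff]
    constructor
    · intro h a c hac b d h1 h2 h3 h4
      by_contra hbd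
      exact h ⟨a, b, c, d, hac, hbd, h1, h2.symm, h4, h3.symm⟩
    · rintro h ⟨a, b, c, d, hac, hbd, h1, h2, h3, h4⟩
      exact hbd (h hac h1 h2.symm h4.symm h3)
  constructor
  · rintro ⟨hle, hfr, hsat⟩
    refine ⟨fun u v h => (hG u v).1 (hle h), fun u v hp hn => ?_, hfree.1 hfr⟩
    obtain ⟨a, b, c, d, hac, hbd, h1, h2, h3, h4⟩ :=
      (cycleGraph_four_isContained_iff _).1 (hsat u v ((hG u v).2 hp) hn)
    have key : ∀ s t : V, (H ⊔ SimpleGraph.edge u v).Adj s t →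
        H.Adj s t ∨ (s = u ∧ t = v) ∨ (s = v ∧ t = u) := by
      intro s t h
      rw [SimpleGraph.sup_adj, SimpleGraph.edge_adj] at h
      tauto
    -- if the side `a b` of the new cycle is `u v`, its other three sides form the path
    have rot : ∀ a b c d : V, a ≠ c → b ≠ d → (H ⊔ SimpleGraph.edge u v).Adj b c →
        (H ⊔ SimpleGraph.edge u v).Adj c d → (H ⊔ SimpleGraph.edge u v).Adj d a →
        a = u → b = v → ∃ x y, H.Adj u x ∧ H.Adj x y ∧ H.Adj y v := by
      rintro a b c d hac hbd h2 h3 h4 rfl rfl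
      refine ⟨d, c, ?_, ?_, ?_⟩
      · rcases key _ _ h4 with h | h | h
        · exact h.symm
        · exact absurd h.2.symm (by rintro rfl; exact hp rfl)
        · exact absurd h.1.symm hbd
      · rcases key _ _ h3 with h | h | h
        · exact h.symm
        · exact absurd h.1.symm hac
        · exact absurd h.1.symm h2.ne
      · rcases key _ _ h2 with h | h | h
        · exact h.symm
        · exact absurd h.1.symm (by rintro rfl; exact hp rfl)
        · exact absurd h.2.symm hac
    rcases key _ _ h1 with g1 | g1 | g1
    · rcases key _ _ h2 with g2 | g2 | g2
      · rcases key _ _ h3 with g3 | g3 | g3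
        · rcases key _ _ h4 with g4 | g4 | g4
          · exact absurd ⟨a, b, c, d, hac, hbd, g1, g2, g3, g4⟩
              ((cycleGraph_four_isContained_iff H).not.1 hfr)
          · exact rot d a b c hbd.symm hac h1 h2 h3 g4.1 g4.2
          · exact rot a d c b hac hbd.symm h3.symm h2.symm h1.symm g4.2 g4.1
        · exact rot c d a b hac.symm hbd.symm h4 h1 h2 g3.1 g3.2
        · exact rot d c b a hbd.symm hac.symm h2.symm h1.symm h4.symm g3.2 g3.1
      · exact rot b c d a hbd hac.symm h3 h4 h1 g2.1 g2.2
      · exact rot c b a d hac.symm hbd h1.symm h4.symm h3.symm g2.2 g2.1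
    · exact rot a b c d hac hbd h2 h3 h4 g1.1 g1.2
    · exact rot b a d c hbd hac h4.symm h3.symm h2.symm g1.2 g1.1
  · intro h
    refine ⟨fun u v huv => (hG u v).2 (h.proper huv), hfree.2 h.unique, fun u v huv hn => ?_⟩
    obtain ⟨x, y, h1, h2, h3⟩ := h.join ((hG u v).1 huv) hn
    have hsub : H ≤ H ⊔ SimpleGraph.edge u v := le_sup_left
    refine (cycleGraph_four_isContained_iff _).2 ⟨u, x, y, v, ?_, ?_, hsub h1, hsub h2, hsub h3, ?_⟩
    · rintro rfl
      exact hn h3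
    · rintro rfl
      exact hn h1
    · refine Or.inr ?_
      rw [SimpleGraph.edge_adj]
      exact ⟨Or.inr ⟨rfl, rfl⟩, huv.ne'⟩

namespace IsC4Saturated

variable {V ι : Type*} {H : SimpleGraph V} {p : V → ι}

theorem exists_adj (h : IsC4Saturated H p) {u v : V} (hp : p u ≠ p v) : ∃ x, H.Adj u x := by
  by_cases huv : H.Adj u v
  · exact ⟨v, huv⟩
  · obtain ⟨x, y, hx, -⟩ := h.join hp huv
    exact ⟨x, hx⟩

end IsC4Saturated

/-! ### The lower bound in the presence of a leaf -/

namespace IsC4Saturated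

variable {V ι : Type*} {H : SimpleGraph V} {p : V → ι}

theorem adj_of_leaves (h : IsC4Saturated H p) {u u' x x' : V} (hx : ∀ y, H.Adj u y ↔ y = x)
    (hx' : ∀ y, H.Adj u' y ↔ y = x') (hp : p u ≠ p u') : H.Adj x x' := by
  by_cases hu : H.Adj u u'
  · rw [← (hx u').1 hu, ← (hx' u).1 hu.symm]
    exact hu.symm
  · obtain ⟨s, t, h1, h2, h3⟩ := h.join hp hu
    rwa [(hx s).1 h1, (hx' t).1 h3.symm] at h2

/-- Leaves from three different parts hang from the three vertices of a triangle, and all leaves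
in the part of any of them then hang from the same vertex of that triangle. -/
theorem support_eq_of_leaves (h : IsC4Saturated H p) {s : V → V} {u v w u' : V}
    (hu : ∀ y, H.Adj u y ↔ y = s u) (hv : ∀ y, H.Adj v y ↔ y = s v)
    (hw : ∀ y, H.Adj w y ↔ y = s w) (hu' : ∀ y, H.Adj u' y ↔ y = s u')
    (huv : p u ≠ p v) (huw : p u ≠ p w) (hvw : p v ≠ p w) (hp : p u' = p u) : s u' = s u :=
  h.unique (h.adj_of_leaves hv hw hvw).ne
    (h.adj_of_leaves hv hu' (by rw [hp]; exact huv.symm))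
    (h.adj_of_leaves hw hu' (by rw [hp]; exact huw.symm))
    (h.adj_of_leaves hv hu huv.symm) (h.adj_of_leaves hw hu huw.symm)

/-- Four leaves in four different parts would force a `K₄` on their supports. -/
theorem not_four_leaves (h : IsC4Saturated H p) {s : V → V} {u v w z : V}
    (hu : ∀ y, H.Adj u y ↔ y = s u) (hv : ∀ y, H.Adj v y ↔ y = s v)
    (hw : ∀ y, H.Adj w y ↔ y = s w) (hz : ∀ y, H.Adj z y ↔ y = s z)
    (huv : p u ≠ p v) (huw : p u ≠ p w) (hvw : p v ≠ p w)
    (huz : p u ≠ p z) (hvz : p v ≠ p z) (hwz : p w ≠ p z) : False :=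
  (h.adj_of_leaves hu hz huz).ne <| h.unique (h.adj_of_leaves hv hw hvw).ne
    (h.adj_of_leaves hv hu huv.symm) (h.adj_of_leaves hw hu huw.symm)
    (h.adj_of_leaves hv hz hvz) (h.adj_of_leaves hw hz hwz)

variable [Fintype V] [DecidableEq V] [DecidableRel H.Adj] [DecidableEq ι]

/-- A leaf `u` taken from a part with the largest number of leaves has few leaves outside its
part. -/
theorem exists_leaf (h : IsC4Saturated H p) {n : ℕ} (hn : ∀ v, #{w | p w = p v} = n)
    (hleaf : ∃ u, H.degree u = 1) :
    ∃ u x, (∀ y, H.Adj u y ↔ y = x) ∧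
      #{w | H.degree w = 1 ∧ p w ≠ p u} ≤ n + #{w | H.Adj x w ∧ p w = p u} := by
  have hs : ∀ u, ∃ x, H.degree u = 1 → ∀ y, H.Adj u y ↔ y = x := by
    intro u
    by_cases hu : H.degree u = 1
    · obtain ⟨x, hx⟩ := Finset.card_eq_one.1 hu
      refine ⟨x, fun _ y => ?_⟩
      rw [← SimpleGraph.mem_neighborFinset, hx, Finset.mem_singleton]
    · exact ⟨u, fun hu' => absurd hu' hu⟩
  choose s hs using hs
  have hbound : ∀ v, #{w | H.degree w = 1 ∧ p w = p v} ≤ n := fun v => by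
    rw [← hn v]
    exact card_le_card fun w hw => by simp at hw ⊢; exact hw.2
  obtain ⟨u₀, hu₀⟩ := hleaf
  obtain ⟨u, hu, hmax⟩ := Finset.exists_max_image ({u | H.degree u = 1} : Finset V)
    (fun u => #{w | H.degree w = 1 ∧ p w = p u}) ⟨u₀, by simpa using hu₀⟩
  simp only [mem_filter, mem_univ, true_and] at hu hmax
  refine ⟨u, s u, hs u hu, ?_⟩
  by_cases h1 : ∃ v, H.degree v = 1 ∧ p v ≠ p u
  · obtain ⟨v, hv, hvu⟩ := h1
    by_cases h2 : ∃ w, H.degree w = 1 ∧ p w ≠ p u ∧ p w ≠ p v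
    · obtain ⟨w, hw, hwu, hwv⟩ := h2
      have hsub : ({z | H.degree z = 1 ∧ p z ≠ p u} : Finset V) ⊆
          ({z | H.degree z = 1 ∧ p z = p v} : Finset V) ∪
          ({z | H.degree z = 1 ∧ p z = p w} : Finset V) := by
        intro z hz
        simp only [mem_filter, mem_univ, true_and, mem_union] at hz ⊢
        by_contra hcon
        push Not at hcon
        exact h.not_four_leaves (hs u hu) (hs v hv) (hs w hw) (hs z hz.1) hvu.symm hwu.symm
          hwv.symm hz.2.symm (hcon.1 hz.1).symm (hcon.2 hz.1).symm
      have hatt : ({z | H.degree z = 1 ∧ p z = p u} : Finset V) ⊆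
          ({z | H.Adj (s u) z ∧ p z = p u} : Finset V) := by
        intro z hz
        simp only [mem_filter, mem_univ, true_and] at hz ⊢
        refine ⟨?_, hz.2⟩
        rw [← h.support_eq_of_leaves (hs u hu) (hs v hv) (hs w hw) (hs z hz.1) hvu.symm hwu.symm
          hwv.symm hz.2]
        exact ((hs z hz.1 _).2 rfl).symm
      have := card_le_card hsub
      have := card_union_le ({z | H.degree z = 1 ∧ p z = p v} : Finset V)
          ({z | H.degree z = 1 ∧ p z = p w} : Finset V)
      have := card_le_card hatt
      have := hbound v
      have := hmax w hw
      omega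
    · push Not at h2
      refine le_trans (le_trans (card_le_card ?_) (hbound v)) (Nat.le_add_right _ _)
      intro z hz
      simp only [mem_filter, mem_univ, true_and] at hz ⊢
      exact ⟨hz.1, h2 z hz.1 hz.2⟩
  · push Not at h1
    rw [Finset.card_eq_zero.2]
    · exact Nat.zero_le _
    · rw [filter_eq_empty_iff]
      exact fun z _ hz => hz.2 (h1 z hz.1)

/-- Every vertex outside the part of a leaf `u` is within distance two of the neighbour `x` of
`u`, and counting degrees by the number of neighbours in `N(x)` gives the bound. -/
theorem three_mul_card_le_of_leaf (h : IsC4Saturated H p) {n : ℕ}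
    (hn : ∀ v, #{w | p w = p v} = n) (hpos : ∀ v, 1 ≤ H.degree v)
    (hleaf : ∃ u, H.degree u = 1) :
    3 * Fintype.card V ≤ ∑ v, H.degree v + 3 * n + 3 := by
  obtain ⟨u, x, hx, hfew⟩ := h.exists_leaf hn hleaf
  have hxu : H.Adj x u := ((hx x).2 rfl).symm
  have hpx : p x ≠ p u := h.proper hxu
  set A := H.neighborFinset x with hA
  have hmem : ∀ w, w ∈ A ↔ H.Adj x w := fun w => by rw [hA, SimpleGraph.mem_neighborFinset]
  -- the number of common neighbours of `w` and `x`
  set d : V → ℕ := fun w => #(A.filter fun y => H.Adj w y) with hd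
  have hone : ∀ w, w ≠ x → p w ≠ p u → 1 ≤ d w := by
    intro w hwx hwp
    have huw : ¬ H.Adj u w := fun hh => hwx ((hx w).1 hh)
    obtain ⟨s, t, h1, h2, h3⟩ := h.join hwp.symm huw
    rw [(hx s).1 h1] at h2
    refine card_pos.2 ⟨t, ?_⟩
    rw [mem_filter, hmem]
    exact ⟨h2, h3.symm⟩
  have hAsum : ∑ y ∈ A, H.degree y = ∑ w, d w := by
    have : ∀ y, H.degree y = ∑ w, if H.Adj w y then 1 else 0 := fun y => by
      rw [← SimpleGraph.card_neighborFinset_eq_degree, SimpleGraph.neighborFinset_eq_filter,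
        card_filter]
      simp only [SimpleGraph.adj_comm]
    simp only [this, hd, card_filter]
    exact sum_comm
  have hdx : d x = #A := by
    change #(A.filter fun y => H.Adj x y) = #A
    rw [filter_true_of_mem fun y hy => (hmem y).1 hy]
  have hxA : x ∉ A := by simp [hmem]
  have hsplit : ∑ v, H.degree v =
      ∑ w ∈ univ.erase x, ((if w ∈ A then 2 else H.degree w) + d w) := by
    have e1 : ∑ v, H.degree v = ∑ v ∈ A, H.degree v +
        (#A + ∑ v ∈ (univ.erase x) \ A, H.degree v) := by
      rw [← add_sum_erase _ _ (mem_univ x), ← sum_sdiff (s₁ := A) (s₂ := univ.erase x)]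
      · have : #A = H.degree x := by rw [hA, SimpleGraph.card_neighborFinset_eq_degree]
        omega
      · intro y hy
        rw [mem_erase]
        exact ⟨fun hh => hxA (hh ▸ hy), mem_univ _⟩
    have e2 : ∑ w ∈ univ.erase x, (if w ∈ A then 2 else H.degree w) =
        2 * #A + ∑ v ∈ (univ.erase x) \ A, H.degree v := by
      rw [sum_ite, sum_const, smul_eq_mul, mul_comm]
      congr 3
      · ext y
        simp only [mem_filter, mem_erase, mem_univ, and_true]
        exact ⟨fun hh => hh.2, fun hh => ⟨fun hy => hxA (hy ▸ hh), hh⟩⟩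
      · rw [sdiff_eq_filter]
    have e3 := add_sum_erase univ d (mem_univ x)
    rw [sum_add_distrib, e1, e2, hAsum, ← e3, hdx]
    omega
  -- `2` for a vertex of `A` accounts for its edge to `x`, which `d` does not see, from both ends
  have hpt : ∀ w ∈ univ.erase x, 3 + (if H.Adj x w ∧ p w = p u then 1 else 0) ≤
      (((if w ∈ A then 2 else H.degree w) + d w) +
        (if H.degree w = 1 ∧ p w ≠ p u then 1 else 0)) + 2 * (if p w = p u then 1 else 0) := by
    intro w hw
    have hwx : w ≠ x := (mem_erase.1 hw).1
    have h1 := hpos w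
    have h2 := hone w hwx
    by_cases hwA : w ∈ A
    · have h3 := (hmem w).1 hwA
      by_cases hp : p w = p u
      · simp [hwA, h3, hp]
      · have := h2 hp
        simp [hwA, hp]
        omega
    · have h3 : ¬ H.Adj x w := fun hh => hwA ((hmem w).2 hh)
      by_cases hp : p w = p u
      · simp [hwA, h3, hp]
        omega
      · have := h2 hp
        by_cases hl : H.degree w = 1
        · simp [hwA, hp, hl]
          omega
        · simp [hwA, hp, hl]
          omega
  have hsum := sum_le_sum hpt
  rw [sum_add_distrib, sum_add_distrib, sum_add_distrib, ← hsplit, ← mul_sum] at hsum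
  simp only [sum_const, smul_eq_mul, ← card_filter] at hsum
  have c1 : #(univ.erase x) = Fintype.card V - 1 := by
    rw [card_erase_of_mem (mem_univ _), card_univ]
  have c2 : #((univ.erase x).filter fun w => H.Adj x w ∧ p w = p u) =
      #{w | H.Adj x w ∧ p w = p u} := by
    congr 1
    ext y
    simp only [mem_filter, mem_erase, mem_univ, and_true, true_and, and_iff_right_iff_imp]
    exact fun hy hyx => hpx (hyx ▸ hy.2)
  have c3 : #((univ.erase x).filter fun w => H.degree w = 1 ∧ p w ≠ p u) ≤
      #{w | H.degree w = 1 ∧ p w ≠ p u} := card_le_card (filter_subset_filter _ (erase_subset _ _))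
  have c4 : #((univ.erase x).filter fun w => p w = p u) ≤ n := by
    rw [← hn u]
    exact card_le_card (filter_subset_filter _ (erase_subset _ _))
  rw [c1, c2] at hsum
  omega

end IsC4Saturated

/-! ### Deficient vertices below a vertex of degree two -/

/-- Relative to a set `C` and a parent map `par` on it, the vertex `w ∉ C` is deficient below `a`
if its only neighbours are `a` and its children in `C`, and every child has at most one neighbour
other than `w`. -/
structure IsDeficient {V : Type*} (H : SimpleGraph V) (C : Set V) (par : V → V) (a w : V) :
    Prop where
  adj : H.Adj a w
  notMem : w ∉ C
  nbr : ∀ ⦃y⦄, H.Adj w y → y = a ∨ (y ∈ C ∧ par y = w)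
  two : ∀ ⦃c⦄, c ∈ C → par c = w → ∀ ⦃d e⦄, H.Adj c d → H.Adj c e → d ≠ w → e ≠ w → d = e

/-- Two adjacent children `c` and `d` of `w` and `z` that have no neighbours besides each other and
their parents. -/
structure IsLink {V : Type*} (H : SimpleGraph V) (C : Set V) (par : V → V) (w z c d : V) :
    Prop where
  left_mem : c ∈ C
  right_mem : d ∈ C
  par_left : par c = w
  par_right : par d = z
  adj_left_iff : ∀ ⦃y⦄, H.Adj c y ↔ y = w ∨ y = d
  adj_right_iff : ∀ ⦃y⦄, H.Adj d y ↔ y = z ∨ y = c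

theorem IsLink.symm {V : Type*} {H : SimpleGraph V} {C : Set V} {par : V → V} {w z c d : V}
    (L : IsLink H C par w z c d) : IsLink H C par z w d c :=
  ⟨L.right_mem, L.left_mem, L.par_right, L.par_left, L.adj_right_iff, L.adj_left_iff⟩

theorem IsLink.adj {V : Type*} {H : SimpleGraph V} {C : Set V} {par : V → V} {w z c d : V}
    (L : IsLink H C par w z c d) : H.Adj c d := L.adj_left_iff.2 (Or.inr rfl)

section

variable {V : Type*} {H : SimpleGraph V} {C : Set V} {par : V → V} {a b w w' y : V}

theorem IsDeficient.not_adj_of_par_ne (hw : IsDeficient H C par a w) (ha : a ∉ C) (hy : y ∈ C)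
    (hpar : par y ≠ w) : ¬ H.Adj w y := by
  intro hwy
  rcases hw.nbr hwy with rfl | hh
  · exact ha hy
  · exact hpar hh.2

theorem IsDeficient.not_adj (hw : IsDeficient H C par a w) (hw' : IsDeficient H C par b w')
    (hab : ¬ H.Adj a b) : ¬ H.Adj w w' := by
  intro hww
  rcases hw.nbr hww with rfl | hh
  · exact hab hw'.adj.symm
  · exact hw'.notMem hh.1

end

namespace IsC4Saturated

variable {V ι : Type*} {H : SimpleGraph V} {p : V → ι} {C : Set V} {par : V → V}

theorem part_eq_of_nbr (h : IsC4Saturated H p) {c d w c' d' w' : V}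
    (hc : ∀ ⦃y⦄, H.Adj c y ↔ y = w ∨ y = d) (hc' : ∀ ⦃y⦄, H.Adj c' y ↔ y = w' ∨ y = d')
    (hcc : ¬ H.Adj c c') (h1 : ¬ H.Adj w w') (h2 : ¬ H.Adj w d') (h3 : ¬ H.Adj d w')
    (h4 : ¬ H.Adj d d') : p c = p c' := by
  by_contra hp
  obtain ⟨x, y, hx, hxy, hy⟩ := h.join hp hcc
  rcases hc.1 hx with rfl | rfl <;> rcases hc'.1 hy.symm with rfl | rfl
  · exact h1 hxy
  · exact h2 hxy
  · exact h3 hxy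
  · exact h4 hxy

/-- Deficient vertices in different parts can only be joined through their children. -/
theorem exists_link (h : IsC4Saturated H p) {a b w z : V} (hCa : ∀ c ∈ C, ¬ H.Adj a c)
    (hCb : ∀ c ∈ C, ¬ H.Adj b c) (hab : ¬ H.Adj a b) (hw : IsDeficient H C par a w)
    (hz : IsDeficient H C par b z) (hp : p w ≠ p z) : ∃ c d, IsLink H C par w z c d := by
  obtain ⟨c, d, h1, h2, h3⟩ := h.join hp (hw.not_adj hz hab)
  rcases hw.nbr h1 with rfl | hc <;> rcases hz.nbr h3.symm with rfl | hd
  · exact absurd h2 hab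
  · exact absurd h2 (hCa _ hd.1)
  · exact absurd h2.symm (hCb _ hc.1)
  · have hdw : d ≠ w := fun hh => hw.notMem (hh ▸ hd.1)
    have hcz : c ≠ z := fun hh => hz.notMem (hh ▸ hc.1)
    refine ⟨c, d, hc.1, hd.1, hc.2, hd.2, fun y => ⟨fun hy => ?_, ?_⟩, fun y => ⟨fun hy => ?_, ?_⟩⟩
    · by_cases hyw : y = w
      · exact Or.inl hyw
      · exact Or.inr (hw.two hc.1 hc.2 hy h2 hyw hdw)
    · rintro (rfl | rfl)
      exacts [h1.symm, h2]
    · by_cases hyz : y = z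
      · exact Or.inl hyz
      · exact Or.inr (hz.two hd.1 hd.2 hy h2.symm hyz hcz)
    · rintro (rfl | rfl)
      exacts [h3, h2.symm]

/-- The paths of length two from `c` lead to neighbours of `w` and to `z`, so a vertex `t` adjacent to
none of these lies in the part of `c`. -/
theorem part_eq_of_link (h : IsC4Saturated H p) {w z c d t : V} (L : IsLink H C par w z c d)
    (hw : ∀ y, H.Adj w y → ¬ H.Adj y t) (hz : ¬ H.Adj z t) : p c = p t := by
  have hct : ¬ H.Adj c t := hw c (L.adj_left_iff.2 (Or.inl rfl)).symm
  by_contra hp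
  obtain ⟨x, y, hx, hxy, hy⟩ := h.join hp hct
  rcases L.adj_left_iff.1 hx with rfl | rfl
  · exact hw y hxy hy
  · rcases L.adj_right_iff.1 hxy with rfl | rfl
    · exact hz hy
    · exact hct hy

/-- The children by which three deficient vertices below `a` in different parts are pairwise linked
would all lie in one part, although linked children are adjacent. -/
theorem not_three_deficient (h : IsC4Saturated H p) {a w₁ w₂ w₃ : V} (ha : a ∉ C)
    (hCa : ∀ c ∈ C, ¬ H.Adj a c) (h₁ : IsDeficient H C par a w₁) (h₂ : IsDeficient H C par a w₂)
    (h₃ : IsDeficient H C par a w₃) (h12 : p w₁ ≠ p w₂) (h13 : p w₁ ≠ p w₃) (h23 : p w₂ ≠ p w₃) :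
    False := by
  have haa := H.irrefl (v := a)
  -- links from two vertices to the same third one
  have opp : ∀ {w z u c d c' d' : V}, IsDeficient H C par a w → IsDeficient H C par a z →
      IsDeficient H C par a u → p w ≠ p z → p w ≠ p u → p z ≠ p u → IsLink H C par w z c d →
      IsLink H C par u z c' d' → p c = p c' := by
    intro w z u c d c' d' hw hz hu hwz hwu hzu L L'
    have hwz : w ≠ z := fun e => hwz (e ▸ rfl)
    have hwu : w ≠ u := fun e => hwu (e ▸ rfl)
    have hzu : z ≠ u := fun e => hzu (e ▸ rfl)
    refine h.part_eq_of_nbr L.adj_left_iff L'.adj_left_iff ?_ (hw.not_adj hu haa)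
      (hw.not_adj_of_par_ne ha L'.right_mem (by rw [L'.par_right]; exact hwz.symm))
      (fun e => hu.not_adj_of_par_ne ha L.right_mem (by rw [L.par_right]; exact hzu) e.symm) ?_
    · rw [L.adj_left_iff]
      rintro (e | e)
      · exact hw.notMem (e ▸ L'.left_mem)
      · exact hzu (by rw [← L.par_right, ← L'.par_left, e])
    · rw [L.adj_right_iff]
      rintro (e | e)
      · exact hz.notMem (e ▸ L'.right_mem)
      · exact hwz (by rw [← L.par_left, ← L'.par_right, e])
  -- links from one vertex to two others
  have sib : ∀ {w z u c d c' d' : V}, IsDeficient H C par a w → IsDeficient H C par a z →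
      IsDeficient H C par a u → p w ≠ p z → p w ≠ p u → p z ≠ p u → IsLink H C par w z c d →
      IsLink H C par w u c' d' → p c = p c' := by
    intro w z u c d c' d' hw hz hu hwz hwu hzu L L'
    have hwz : w ≠ z := fun e => hwz (e ▸ rfl)
    have hwu : w ≠ u := fun e => hwu (e ▸ rfl)
    have hzu : z ≠ u := fun e => hzu (e ▸ rfl)
    refine h.part_eq_of_nbr L.adj_left_iff L'.adj_left_iff ?_ H.irrefl
      (hw.not_adj_of_par_ne ha L'.right_mem (by rw [L'.par_right]; exact hwu.symm))
      (fun e => hw.not_adj_of_par_ne ha L.right_mem (by rw [L.par_right]; exact hwz.symm) e.symm) ?_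
    · rw [L.adj_left_iff]
      rintro (e | e)
      · exact hw.notMem (e ▸ L'.left_mem)
      · exact hwz (by rw [← L.par_right, ← L'.par_left, e])
    · rw [L.adj_right_iff]
      rintro (e | e)
      · exact hz.notMem (e ▸ L'.right_mem)
      · exact hwu (by rw [← L.par_left, ← L'.par_right, e])
  obtain ⟨c12, c21, L12⟩ := h.exists_link hCa hCa haa h₁ h₂ h12
  obtain ⟨c13, c31, L13⟩ := h.exists_link hCa hCa haa h₁ h₃ h13
  obtain ⟨c23, c32, L23⟩ := h.exists_link hCa hCa haa h₂ h₃ h23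
  have e1 := sib h₁ h₂ h₃ h12 h13 h23 L12 L13
  have e2 := opp h₁ h₃ h₂ h13 h12 h23.symm L13 L23
  have e3 := sib h₂ h₃ h₁ h23 h12.symm h13.symm L23 L12.symm
  exact h.proper L12.adj (e1.trans (e2.trans e3))

/-- Deficient vertices below `a` in different parts would leave `b` out of reach of one of the linked
children if `a` and `b` are not adjacent. -/
theorem part_eq_of_deficient (h : IsC4Saturated H p) {a b w z : V}
    (hCa : ∀ c ∈ C, ¬ H.Adj a c) (hCb : ∀ c ∈ C, ¬ H.Adj b c) (hab : ¬ H.Adj a b)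
    (hw : IsDeficient H C par a w) (hz : IsDeficient H C par a z)
    (hbw : ¬ H.Adj b w) (hbz : ¬ H.Adj b z) : p w = p z := by
  by_contra hp
  obtain ⟨c, d, L⟩ := h.exists_link hCa hCa H.irrefl hw hz hp
  have hN : ∀ w, IsDeficient H C par a w → ∀ y, H.Adj w y → ¬ H.Adj y b := by
    intro w hw y hy
    rcases hw.nbr hy with rfl | hh
    · exact hab
    · exact fun e => hCb y hh.1 e.symm
  refine h.proper L.adj ?_
  rw [h.part_eq_of_link L (hN w hw) fun e => hbz e.symm,
    h.part_eq_of_link L.symm (hN z hz) fun e => hbw e.symm]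

/-- A deficient vertex below `b` would be out of reach of one of the linked children of two deficient
vertices below `a` in different parts. -/
theorem part_eq_of_deficient_of_deficient (h : IsC4Saturated H p) {a b w z t : V}
    (ha : a ∉ C) (hb : b ∉ C) (hCa : ∀ c ∈ C, ¬ H.Adj a c)
    (hw : IsDeficient H C par a w) (hz : IsDeficient H C par a z) (ht : IsDeficient H C par b t)
    (hat : ¬ H.Adj a t) (hta : t ≠ a) : p w = p z := by
  by_contra hp
  obtain ⟨c, d, L⟩ := h.exists_link hCa hCa H.irrefl hw hz hp
  have hN : ∀ w, IsDeficient H C par a w → ∀ y, H.Adj w y → ¬ H.Adj y t := by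
    intro w hw y hy
    rcases hw.nbr hy with rfl | hh
    · exact hat
    · have : w ≠ t := fun e => hat (e ▸ hw.adj)
      exact fun e => ht.not_adj_of_par_ne hb hh.1 (by rw [hh.2]; exact this) e.symm
  have hA : ∀ w, IsDeficient H C par a w → ¬ H.Adj w t := by
    intro w hw e
    rcases hw.nbr e with e | e
    · exact hta e
    · exact ht.notMem e.1
  refine h.proper L.adj ?_
  rw [h.part_eq_of_link L (hN w hw) (hA z hz), h.part_eq_of_link L.symm (hN z hz) (hA w hw)]

/-- The child of `w` linking it to `z` must lie in the part of `a`. -/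
theorem link_part_eq (h : IsC4Saturated H p) {a w z c d : V} (hCa : ∀ c ∈ C, ¬ H.Adj a c)
    (hw : IsDeficient H C par a w) (haz : ¬ H.Adj a z) (L : IsLink H C par w z c d) :
    p c = p a := by
  refine h.part_eq_of_link L (fun y hy => ?_) fun e => haz e.symm
  rcases hw.nbr hy with rfl | hh
  · exact H.irrefl
  · exact fun e => hCa y hh.1 e.symm

/-- Two deficient vertices below `a` in one part and two below `b` in another part cannot coexist
if `a` and `b` are not adjacent. -/
theorem not_two_and_two_deficient (h : IsC4Saturated H p) {a b w w' z z' : V}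
    (ha : a ∉ C) (hb : b ∉ C) (hCa : ∀ c ∈ C, ¬ H.Adj a c) (hCb : ∀ c ∈ C, ¬ H.Adj b c)
    (hab : ¬ H.Adj a b) (hw : IsDeficient H C par a w) (hw' : IsDeficient H C par a w')
    (hz : IsDeficient H C par b z) (hz' : IsDeficient H C par b z')
    (hbw : ¬ H.Adj b w) (hbw' : ¬ H.Adj b w') (haz : ¬ H.Adj a z) (haz' : ¬ H.Adj a z')
    (hww : w ≠ w') (hzz : z ≠ z') (hp : p w ≠ p z) (hp' : p w' ≠ p z') : False := by
  obtain ⟨c, d, L⟩ := h.exists_link hCa hCb hab hw hz hp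
  obtain ⟨c', d', L'⟩ := h.exists_link hCa hCb hab hw' hz' hp'
  have e1 := h.link_part_eq hCa hw haz L
  have e2 := h.link_part_eq hCb hz hbw L.symm
  have e3 := h.link_part_eq hCb hz' hbw' L'.symm
  have hwz' : w ≠ z' := fun e => haz' (e ▸ hw.adj)
  have hw'z : w' ≠ z := fun e => haz (e ▸ hw'.adj)
  have : p c = p d' := by
    refine h.part_eq_of_nbr L.adj_left_iff L'.adj_right_iff ?_ (hw.not_adj hz' hab)
      (hw.not_adj_of_par_ne ha L'.left_mem (by rw [L'.par_left]; exact hww.symm))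
      (fun e => hz'.not_adj_of_par_ne hb L.right_mem (by rw [L.par_right]; exact hzz) e.symm) ?_
    · rw [L.adj_left_iff]
      rintro (e | e)
      · exact hw.notMem (e ▸ L'.right_mem)
      · exact hzz (by rw [← L.par_right, ← L'.par_right, e])
    · rw [L.adj_right_iff]
      rintro (e | e)
      · exact hz.notMem (e ▸ L'.left_mem)
      · exact hww (by rw [← L.par_left, ← L'.par_left, e])
  exact h.proper L.adj (by rw [this, e3, e2])

variable [Fintype V] [DecidableEq ι]

theorem card_le_of_part_eq {n : ℕ} (hn : ∀ v, #{w | p w = p v} = n) {S : Finset V}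
    (hS : ∀ w ∈ S, ∀ z ∈ S, p w = p z) : #S ≤ n := by
  rcases S.eq_empty_or_nonempty with rfl | ⟨v, hv⟩
  · simp
  · rw [← hn v]
    exact card_le_card fun w hw => by simpa using hS w hw v hv

variable [DecidableEq V]

/-- If `a` and `b` are adjacent, there are at most `2n` deficient vertices. -/
theorem card_deficient_le_of_adj (h : IsC4Saturated H p) {n : ℕ}
    (hn : ∀ v, #{w | p w = p v} = n) {a b : V} (ha : a ∉ C) (hb : b ∉ C)
    (hCa : ∀ c ∈ C, ¬ H.Adj a c) (hCb : ∀ c ∈ C, ¬ H.Adj b c) {S T : Finset V}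
    (hS : ∀ w ∈ S, IsDeficient H C par a w ∧ ¬ H.Adj b w ∧ w ≠ b)
    (hT : ∀ w ∈ T, IsDeficient H C par b w ∧ ¬ H.Adj a w ∧ w ≠ a) : #S + #T ≤ 2 * n := by
  -- two parts on one side: nothing on the other side, and no third part
  have key : ∀ (a b : V) (S T : Finset V), a ∉ C → b ∉ C → (∀ c ∈ C, ¬ H.Adj a c) →
      (∀ w ∈ S, IsDeficient H C par a w) →
      (∀ w ∈ T, IsDeficient H C par b w ∧ ¬ H.Adj a w ∧ w ≠ a) →
      (∃ w ∈ S, ∃ z ∈ S, p w ≠ p z) → #S + #T ≤ 2 * n := by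
    rintro a b S T ha hb hCa hS hT ⟨w, hw, z, hz, hp⟩
    have hTe : T = ∅ := by
      rw [eq_empty_iff_forall_notMem]
      intro t ht
      exact hp (h.part_eq_of_deficient_of_deficient ha hb hCa (hS w hw) (hS z hz) (hT t ht).1
        (hT t ht).2.1 (hT t ht).2.2)
    have hsub : S ⊆ ({u | p u = p w} : Finset V) ∪ ({u | p u = p z} : Finset V) := by
      intro u hu
      simp only [mem_union, mem_filter, mem_univ, true_and]
      by_contra hcon
      push Not at hcon
      exact h.not_three_deficient ha hCa (hS w hw) (hS z hz) (hS u hu) hp hcon.1.symm hcon.2.symm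
    have h1 := card_le_card hsub
    have h2 := card_union_le ({u | p u = p w} : Finset V) ({u | p u = p z} : Finset V)
    rw [hn, hn] at h2
    rw [hTe, card_empty]
    omega
  by_cases hS2 : ∃ w ∈ S, ∃ z ∈ S, p w ≠ p z
  · exact key a b S T ha hb hCa (fun w hw => (hS w hw).1) hT hS2
  by_cases hT2 : ∃ w ∈ T, ∃ z ∈ T, p w ≠ p z
  · rw [add_comm]
    exact key b a T S hb ha hCb (fun w hw => (hT w hw).1) hS hT2
  push Not at hS2 hT2
  have := card_le_of_part_eq hn hS2
  have := card_le_of_part_eq hn hT2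
  omega

/-- If `a` and `b` are not adjacent, there are fewer than `2n` deficient vertices. -/
theorem card_deficient_lt_of_not_adj (h : IsC4Saturated H p) {n : ℕ}
    (hn : ∀ v, #{w | p w = p v} = n) {a b : V} (ha : a ∉ C) (hb : b ∉ C)
    (hCa : ∀ c ∈ C, ¬ H.Adj a c) (hCb : ∀ c ∈ C, ¬ H.Adj b c) (hab : ¬ H.Adj a b)
    {S T : Finset V} (hS : ∀ w ∈ S, IsDeficient H C par a w ∧ ¬ H.Adj b w)
    (hT : ∀ w ∈ T, IsDeficient H C par b w ∧ ¬ H.Adj a w) : #S + #T < 2 * n := by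
  have hn0 : 1 ≤ n := by
    rw [← hn a]
    exact card_pos.2 ⟨a, by simp⟩
  have hS1 : ∀ w ∈ S, ∀ z ∈ S, p w = p z := fun w hw z hz =>
    h.part_eq_of_deficient hCa hCb hab (hS w hw).1 (hS z hz).1 (hS w hw).2 (hS z hz).2
  have hT1 : ∀ w ∈ T, ∀ z ∈ T, p w = p z := fun w hw z hz =>
    h.part_eq_of_deficient hCb hCa (fun e => hab e.symm) (hT w hw).1 (hT z hz).1 (hT w hw).2
      (hT z hz).2
  have hSn := card_le_of_part_eq hn hS1
  have hTn := card_le_of_part_eq hn hT1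
  by_contra! hlt
  have hSc : #S = n := by omega
  have hTc : #T = n := by omega
  obtain ⟨w, hw⟩ : S.Nonempty := card_pos.1 (by omega)
  obtain ⟨z, hz⟩ : T.Nonempty := card_pos.1 (by omega)
  by_cases hp : p w = p z
  · -- `S` and `T` are disjoint subsets of one part
    have hdisj : Disjoint S T := disjoint_left.2 fun u hu hu' => (hS u hu).2 (hT u hu').1.adj
    have : #(S ∪ T) ≤ n := card_le_of_part_eq hn (by
      have : ∀ u ∈ S ∪ T, p u = p z := by
        intro u hu
        rcases mem_union.1 hu with hu | hu
        · rw [hS1 u hu w hw, hp]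
        · exact hT1 u hu z hz
      exact fun u hu u' hu' => (this u hu).trans (this u' hu').symm)
    rw [card_union_of_disjoint hdisj] at this
    omega
  · rcases Nat.lt_or_ge 1 n with hn1 | hn1
    · obtain ⟨w', hw', hww⟩ := exists_mem_ne (by omega : 1 < #S) w
      obtain ⟨z', hz', hzz⟩ := exists_mem_ne (by omega : 1 < #T) z
      exact h.not_two_and_two_deficient ha hb hCa hCb hab (hS w hw).1 (hS w' hw').1 (hT z hz).1
        (hT z' hz').1 (hS w hw).2 (hS w' hw').2 (hT z hz).2 (hT z' hz').2 hww.symm hzz.symm hp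
        (by rwa [hS1 w' hw' w hw, hT1 z' hz' z hz])
    · -- with parts of size one, the linking child of `w` would be `a` itself
      obtain ⟨c, d, L⟩ := h.exists_link hCa hCb hab (hS w hw).1 (hT z hz).1 hp
      have hpc := h.link_part_eq hCa (hS w hw).1 (hT z hz).2 L
      have hone := hn a
      have hca : c ≠ a := fun e => ha (e ▸ L.left_mem)
      have : 1 < #{u | p u = p a} := one_lt_card.2 ⟨c, by simpa using hpc, a, by simp, hca⟩
      omega

end IsC4Saturated

/-! ### The lower bound in the absence of leaves -/

namespace IsC4Saturated

variable {V ι : Type*} {H : SimpleGraph V} {p : V → ι} [Fintype V] [DecidableEq V]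
  [DecidableRel H.Adj] [DecidableEq ι]

/-- A vertex `w` and its children have the degrees expected from a contribution of `3/2` edges per
vertex, unless `w` is deficient. -/
theorem two_add_le_of_not_deficient (hmin : ∀ v, 2 ≤ H.degree v) {C : Finset V} {par : V → V}
    {a w : V} (hpar : ∀ c ∈ C, H.Adj (par c) c) (ha : a ∉ C) (haw : H.Adj a w) (hw : w ∉ C)
    (hdef : ¬ IsDeficient H (C : Set V) par a w) :
    2 + 3 * #(C.filter fun c => par c = w) ≤
      H.degree w + ∑ c ∈ C.filter (fun c => par c = w), H.degree c := by
  set K := C.filter fun c => par c = w with hK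
  have hKa : a ∉ K := fun hh => ha (mem_filter.1 hh).1
  have hsub : insert a K ⊆ H.neighborFinset w := by
    intro y hy
    rw [SimpleGraph.mem_neighborFinset]
    rcases mem_insert.1 hy with rfl | hy
    · exact haw.symm
    · have := hpar y (mem_filter.1 hy).1
      rwa [(mem_filter.1 hy).2] at this
  have hc1 : #(insert a K) = #K + 1 := card_insert_of_notMem hKa
  have hc2 := card_le_card hsub
  rw [SimpleGraph.card_neighborFinset_eq_degree, hc1] at hc2
  have hc3 : #K * 2 ≤ ∑ c ∈ K, H.degree c := by
    rw [← smul_eq_mul]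
    exact card_nsmul_le_sum _ _ _ fun c _ => hmin c
  by_contra! hlt
  have heq : insert a K = H.neighborFinset w := by
    refine eq_of_subset_of_card_le hsub ?_
    rw [SimpleGraph.card_neighborFinset_eq_degree]
    omega
  have hdeg : ∀ c ∈ K, 2 = H.degree c := by
    refine (sum_eq_sum_iff_of_le fun c _ => hmin c).1 ?_
    rw [sum_const, smul_eq_mul]
    omega
  refine hdef ⟨haw, by simpa using hw, fun y hy => ?_, fun c hc hcw d e hd he hdw hew => ?_⟩
  · rw [← SimpleGraph.mem_neighborFinset, ← heq, mem_insert] at hy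
    exact hy.imp id fun hy => by simpa [hK] using hy
  · have hcK : c ∈ K := mem_filter.2 ⟨by simpa using hc, hcw⟩
    have hwc : w ∈ H.neighborFinset c := by
      rw [SimpleGraph.mem_neighborFinset, ← hcw]
      exact (hpar c (by simpa using hc)).symm
    have hle : #((H.neighborFinset c).erase w) ≤ 1 := by
      rw [card_erase_of_mem hwc, SimpleGraph.card_neighborFinset_eq_degree, ← hdeg c hcK]
    exact card_le_one.1 hle d (by simp [hdw, hd]) e (by simp [hew, he])

/-- The vertices are sorted by their distance to a vertex `v` of degree two: its neighbours `a` and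
`b`, the set `M` of vertices at distance two, the set `C` at distance three, and the rest `D`, which
lies in the part of `v`. Each vertex of `C` is assigned to one parent in `M`, and the degrees are added
up over the families that this produces. -/
theorem three_mul_card_le_of_degree_eq_two (h : IsC4Saturated H p) {n : ℕ}
    (hn : ∀ v, #{w | p w = p v} = n) (hmin : ∀ v, 2 ≤ H.degree v) {v : V}
    (hv : H.degree v = 2) : 3 * Fintype.card V ≤ ∑ v, H.degree v + 3 * n + 3 := by
  classical
  obtain ⟨a, b, hab, hvab⟩ := card_eq_two.1 hv
  have hvadj : ∀ y, H.Adj v y ↔ y = a ∨ y = b := fun y => by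
    rw [← SimpleGraph.mem_neighborFinset, hvab, mem_insert, mem_singleton]
  have hva : H.Adj v a := (hvadj a).2 (Or.inl rfl)
  have hvb : H.Adj v b := (hvadj b).2 (Or.inr rfl)
  set W : Finset V := univ \ {v, a, b} with hW
  have hWmem : ∀ w, w ∈ W ↔ w ≠ v ∧ w ≠ a ∧ w ≠ b := fun w => by simp [hW]
  set M : Finset V := W.filter fun w => H.Adj a w ∨ H.Adj b w with hM
  have hMmem : ∀ w, w ∈ M ↔ (w ≠ v ∧ w ≠ a ∧ w ≠ b) ∧ (H.Adj a w ∨ H.Adj b w) := fun w => by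
    rw [hM, mem_filter, hWmem]
  set C : Finset V := (W \ M).filter fun c => ∃ w ∈ M, H.Adj w c with hC
  have hCmem : ∀ c, c ∈ C ↔ ((c ≠ v ∧ c ≠ a ∧ c ≠ b) ∧ c ∉ M) ∧ ∃ w ∈ M, H.Adj w c := fun c => by
    rw [hC, mem_filter, mem_sdiff, hWmem]
  set D : Finset V := (W \ M) \ C with hD
  have hnot : ∀ w, w ≠ v → ¬ (H.Adj a w ∧ H.Adj b w) := fun w hw hh =>
    hw (h.unique hab hh.1 hh.2 hva.symm hvb.symm)
  have hpar : ∀ c, ∃ w, c ∈ C → w ∈ M ∧ H.Adj w c := fun c => by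
    by_cases hc : c ∈ C
    · obtain ⟨w, hw⟩ := ((hCmem c).1 hc).2
      exact ⟨w, fun _ => hw⟩
    · exact ⟨c, fun hh => absurd hh hc⟩
  choose par hpar using hpar
  have hMC : ∀ w ∈ M, w ∉ C := fun w hw hh => ((hCmem w).1 hh).1.2 hw
  have haC : a ∉ C := fun hh => ((hCmem a).1 hh).1.1.2.1 rfl
  have hbC : b ∉ C := fun hh => ((hCmem b).1 hh).1.1.2.2 rfl
  have hCa : ∀ c ∈ C, ¬ H.Adj a c := fun c hc hh =>
    ((hCmem c).1 hc).1.2 ((hMmem c).2 ⟨((hCmem c).1 hc).1.1, Or.inl hh⟩)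
  have hCb : ∀ c ∈ C, ¬ H.Adj b c := fun c hc hh =>
    ((hCmem c).1 hc).1.2 ((hMmem c).2 ⟨((hCmem c).1 hc).1.1, Or.inr hh⟩)
  -- vertices further away than distance three lie in the part of `v`
  have hDn : #D + 1 ≤ n := by
    have hDv : v ∉ D := by simp [hD, hWmem]
    rw [← hn v, ← card_insert_of_notMem hDv]
    refine card_le_card fun w hw => ?_
    rw [mem_filter]
    refine ⟨mem_univ _, ?_⟩
    rcases mem_insert.1 hw with rfl | hw
    · rfl
    rw [hD, mem_sdiff, mem_sdiff, hWmem] at hw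
    obtain ⟨⟨hw1, hwM⟩, hwC⟩ := hw
    have hwa : ¬ H.Adj a w := fun e => hwM ((hMmem w).2 ⟨hw1, Or.inl e⟩)
    have hwb : ¬ H.Adj b w := fun e => hwM ((hMmem w).2 ⟨hw1, Or.inr e⟩)
    have hwv : ¬ H.Adj v w := fun e => ((hvadj w).1 e).elim hw1.2.1 hw1.2.2
    by_contra hp
    obtain ⟨x, y, hx, hxy, hy⟩ := h.join (Ne.symm hp) hwv
    have hyM : y ∈ M := by
      refine (hMmem y).2 ⟨⟨?_, ?_, ?_⟩, ?_⟩
      · rintro rfl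
        exact hwv hy
      · rintro rfl
        exact hwa hy
      · rintro rfl
        exact hwb hy
      · rcases (hvadj x).1 hx with rfl | rfl
        exacts [Or.inl hxy, Or.inr hxy]
    exact hwC ((hCmem w).2 ⟨⟨hw1, hwM⟩, y, hyM, hy⟩)
  set S := M.filter fun w => IsDeficient H (C : Set V) par a w with hS
  set T := M.filter fun w => IsDeficient H (C : Set V) par b w with hT
  have hST : ∀ w ∈ M, 2 + 3 * #(C.filter fun c => par c = w) ≤
      (H.degree w + ∑ c ∈ C.filter (fun c => par c = w), H.degree c) +
        ((if IsDeficient H (C : Set V) par a w then 1 else 0) +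
          (if IsDeficient H (C : Set V) par b w then 1 else 0)) := by
    intro w hw
    -- a deficient vertex still has its hub and its children as neighbours
    have hlow : 2 + 3 * #(C.filter fun c => par c = w) ≤
        (H.degree w + ∑ c ∈ C.filter (fun c => par c = w), H.degree c) + 1 := by
      obtain ⟨z, hz, hzC⟩ : ∃ z, H.Adj z w ∧ z ∉ C := by
        rcases ((hMmem w).1 hw).2 with e | e
        exacts [⟨a, e, haC⟩, ⟨b, e, hbC⟩]
      have hsub : insert z (C.filter fun c => par c = w) ⊆ H.neighborFinset w := by
        intro y hy
        rw [SimpleGraph.mem_neighborFinset]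
        rcases mem_insert.1 hy with rfl | hy
        · exact hz.symm
        · have := (hpar y (mem_filter.1 hy).1).2
          rwa [(mem_filter.1 hy).2] at this
      have hc2 := card_le_card hsub
      rw [SimpleGraph.card_neighborFinset_eq_degree, card_insert_of_notMem
        (fun hh => hzC (mem_filter.1 hh).1)] at hc2
      have hc3 : #(C.filter fun c => par c = w) * 2 ≤
          ∑ c ∈ C.filter (fun c => par c = w), H.degree c := by
        rw [← smul_eq_mul]
        exact card_nsmul_le_sum _ _ _ fun c _ => hmin c
      omega
    by_cases h1 : IsDeficient H (C : Set V) par a w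
    · rw [if_pos h1]
      omega
    by_cases h2 : IsDeficient H (C : Set V) par b w
    · rw [if_pos h2]
      omega
    rw [if_neg h1, if_neg h2]
    rcases ((hMmem w).1 hw).2 with e | e
    · exact two_add_le_of_not_deficient hmin (fun c hc => (hpar c hc).2) haC e (hMC w hw) h1
    · exact two_add_le_of_not_deficient hmin (fun c hc => (hpar c hc).2) hbC e (hMC w hw) h2
  have hsum := sum_le_sum hST
  have hmaps : ∀ c ∈ C, par c ∈ M := fun c hc => (hpar c hc).1
  rw [sum_add_distrib, ← mul_sum, sum_const, smul_eq_mul, ← card_eq_sum_card_fiberwise hmaps,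
    sum_add_distrib, sum_add_distrib, sum_fiberwise_of_maps_to hmaps, sum_add_distrib,
    ← card_filter, ← card_filter, ← hS, ← hT] at hsum
  have hDsum : #D * 2 ≤ ∑ c ∈ D, H.degree c := by
    rw [← smul_eq_mul]
    exact card_nsmul_le_sum _ _ _ fun c _ => hmin c
  have hMW : M ⊆ W := filter_subset _ _
  have hCW : C ⊆ W \ M := filter_subset _ _
  have hvabc : #({v, a, b} : Finset V) = 3 := card_eq_three.2 ⟨v, a, b, hva.ne, hvb.ne, hab, rfl⟩
  have hcard : Fintype.card V = 3 + #M + #C + #D := by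
    have e1 := card_sdiff_add_card_eq_card hCW
    have e2 := card_sdiff_add_card_eq_card hMW
    have e3 := card_sdiff_add_card_eq_card (subset_univ ({v, a, b} : Finset V))
    rw [card_univ, ← hW, hvabc] at e3
    rw [← hD] at e1
    omega
  have hdsum : ∑ v, H.degree v = 2 + H.degree a + H.degree b + ∑ w ∈ M, H.degree w +
      ∑ w ∈ C, H.degree w + ∑ w ∈ D, H.degree w := by
    have e1 := sum_sdiff (f := fun w => H.degree w) hCW
    have e2 := sum_sdiff (f := fun w => H.degree w) hMW
    have e3 := sum_sdiff (f := fun w => H.degree w) (subset_univ ({v, a, b} : Finset V))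
    have hsv : ∑ w ∈ ({v, a, b} : Finset V), H.degree w = 2 + (H.degree a + H.degree b) := by
      rw [sum_insert (by simp [hva.ne, hvb.ne]), sum_insert (by simp [hab]), sum_singleton, hv]
    rw [← hW, hsv] at e3
    rw [← hD] at e1
    omega
  have hnei : ∀ x y, H.Adj v x → H.Adj v y → x ≠ y → (∀ z, z = x ∨ z = y ↔ H.Adj v z) →
      H.degree x = 1 + (if H.Adj x y then 1 else 0) + #(M.filter fun w => H.Adj x w) := by
    intro x y hx hy hxy hz
    have : H.neighborFinset x = (insert v (({y} : Finset V).filter fun w => H.Adj x w)) ∪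
        M.filter fun w => H.Adj x w := by
      ext w
      simp only [SimpleGraph.mem_neighborFinset, mem_union, mem_insert, mem_filter, mem_singleton,
        hMmem]
      constructor
      · intro hw
        by_cases hwv : w = v
        · exact Or.inl (Or.inl hwv)
        by_cases hwy : w = y
        · exact Or.inl (Or.inr ⟨hwy, hw⟩)
        have hnv : ¬ H.Adj v w := fun e => ((hz w).2 e).elim (fun e => hw.ne e.symm) hwy
        refine Or.inr ⟨⟨⟨hwv, fun e => hnv (e ▸ hva), fun e => hnv (e ▸ hvb)⟩, ?_⟩, hw⟩
        rcases (hvadj x).1 hx with rfl | rfl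
        exacts [Or.inl hw, Or.inr hw]
      · rintro ((rfl | hw) | hw)
        exacts [hx.symm, hw.2, hw.2]
    have hdis : Disjoint (insert v (({y} : Finset V).filter fun w => H.Adj x w))
        (M.filter fun w => H.Adj x w) := by
      rw [disjoint_left]
      intro w hw hw'
      have hwM := ((hMmem w).1 (mem_filter.1 hw').1).1
      rcases mem_insert.1 hw with rfl | hw
      · exact hwM.1 rfl
      · have : w = y := mem_singleton.1 (mem_filter.1 hw).1
        subst this
        exact ((hvadj w).1 hy).elim hwM.2.1 hwM.2.2
    rw [← SimpleGraph.card_neighborFinset_eq_degree, this, card_union_of_disjoint hdis,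
      card_insert_of_notMem (by simp [hy.ne]), filter_singleton]
    split_ifs <;> simp
  have hda := hnei a b hva hvb hab fun z => (hvadj z).symm
  have hdb := hnei b a hvb hva hab.symm fun z => by rw [hvadj]; exact or_comm
  have hMsplit : #(M.filter fun w => H.Adj a w) + #(M.filter fun w => H.Adj b w) = #M := by
    rw [← card_union_of_disjoint, ← filter_or, filter_true_of_mem fun w hw => ((hMmem w).1 hw).2]
    rw [disjoint_left]
    intro w hw hw'
    exact hnot w ((hMmem w).1 (mem_filter.1 hw).1).1.1 ⟨(mem_filter.1 hw).2, (mem_filter.1 hw').2⟩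
  have hSprop : ∀ w ∈ S, IsDeficient H (C : Set V) par a w ∧ ¬ H.Adj b w ∧ w ≠ b := by
    intro w hw
    rw [hS, mem_filter] at hw
    have hwM := ((hMmem w).1 hw.1).1
    exact ⟨hw.2, fun e => hnot w hwM.1 ⟨hw.2.adj, e⟩, hwM.2.2⟩
  have hTprop : ∀ w ∈ T, IsDeficient H (C : Set V) par b w ∧ ¬ H.Adj a w ∧ w ≠ a := by
    intro w hw
    rw [hT, mem_filter] at hw
    have hwM := ((hMmem w).1 hw.1).1
    exact ⟨hw.2, fun e => hnot w hwM.1 ⟨e, hw.2.adj⟩, hwM.2.1⟩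
  by_cases hadj : H.Adj a b
  · have := h.card_deficient_le_of_adj hn (by simpa using haC) (by simpa using hbC)
      (by simpa using hCa) (by simpa using hCb) hSprop hTprop
    rw [if_pos hadj] at hda
    rw [if_pos hadj.symm] at hdb
    omega
  · have := h.card_deficient_lt_of_not_adj hn (by simpa using haC) (by simpa using hbC)
      (by simpa using hCa) (by simpa using hCb) hadj
      (fun w hw => ⟨(hSprop w hw).1, (hSprop w hw).2.1⟩)
      (fun w hw => ⟨(hTprop w hw).1, (hTprop w hw).2.1⟩)
    rw [if_neg hadj] at hda
    rw [if_neg fun e => hadj e.symm] at hdb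
    omega

/-- The lower bound on the number of edges, as a bound on the degree sum. -/
theorem three_mul_card_le (h : IsC4Saturated H p) {n : ℕ} (hn : ∀ v, #{w | p w = p v} = n)
    (hp : ∀ u, ∃ v, p u ≠ p v) : 3 * Fintype.card V ≤ ∑ v, H.degree v + 3 * n + 3 := by
  have hpos : ∀ v, 1 ≤ H.degree v := fun v => by
    obtain ⟨u, hu⟩ := hp v
    obtain ⟨x, hx⟩ := h.exists_adj hu
    exact card_pos.2 ⟨x, by simpa using hx⟩
  by_cases h1 : ∃ u, H.degree u = 1
  · exact h.three_mul_card_le_of_leaf hn hpos h1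
  push Not at h1
  have hmin : ∀ v, 2 ≤ H.degree v := fun v => by
    have := hpos v
    have := h1 v
    omega
  by_cases h2 : ∃ v, H.degree v = 2
  · obtain ⟨v, hv⟩ := h2
    exact h.three_mul_card_le_of_degree_eq_two hn hmin hv
  push Not at h2
  have : Fintype.card V * 3 ≤ ∑ v, H.degree v := by
    rw [← card_univ, ← smul_eq_mul]
    refine card_nsmul_le_sum _ _ _ fun v _ => ?_
    have := hmin v
    have := h2 v
    omega
  omega

end IsC4Saturated

/-! ### The extremal graphs -/

/-- Three pairwise adjacent hubs `t 0`, `t 1`, `t 2`, with edges and triangles attached to them: the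
vertex `v` is attached to the hub `t (f v)`, and it is joined to `σ v` if it is not fixed by the
involution `σ`. Vertices fixed by `σ` that are not hubs become leaves. -/
def hubGraph {V : Type*} (t : Fin 3 → V) (f : V → Fin 3) (σ : V → V) : SimpleGraph V where
  Adj u v := u ≠ v ∧ ((u = t (f u) ∧ v = t (f v)) ∨
    (f u = f v ∧ (u = t (f u) ∨ v = t (f v))) ∨ v = σ u ∨ u = σ v)
  symm := ⟨fun u v h => ⟨h.1.symm, by
    rcases h.2 with h | h | h | h
    · exact Or.inl ⟨h.2, h.1⟩
    · exact Or.inr (Or.inl ⟨h.1.symm, h.2.symm⟩)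
    · exact Or.inr (Or.inr (Or.inr h))
    · exact Or.inr (Or.inr (Or.inl h))⟩⟩
  loopless := ⟨fun u h => h.1 rfl⟩

section HubGraph

variable {V : Type*} {t : Fin 3 → V} {f : V → Fin 3} {σ : V → V}

theorem hubGraph_adj_hub {v : V} (hv : v ≠ t (f v)) (hft : ∀ i, f (t i) = i) :
    (hubGraph t f σ).Adj v (t (f v)) :=
  ⟨hv, Or.inr (Or.inl ⟨(hft _).symm, Or.inr (by rw [hft])⟩)⟩

theorem hubGraph_adj_hub_hub {i j : Fin 3} (hij : i ≠ j) (hft : ∀ i, f (t i) = i) :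
    (hubGraph t f σ).Adj (t i) (t j) :=
  ⟨fun e => hij (by rw [← hft i, ← hft j, e]), Or.inl ⟨by rw [hft], by rw [hft]⟩⟩

theorem hubGraph_eq_or_eq_of_adj (hσ : ∀ v, σ (σ v) = v)
    {u v : V} (hu : u ≠ t (f u)) (huv : (hubGraph t f σ).Adj u v) :
    v = t (f u) ∨ v = σ u := by
  rcases huv.2 with h | h | h | h
  · exact absurd h.1 hu
  · rcases h.2 with h' | h'
    · exact absurd h' hu
    · exact Or.inl (by rw [h.1]; exact h')
  · exact Or.inr h
  · exact Or.inr (by rw [h, hσ])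

/-- The graph is `C₄`-saturated if leaves at the same hub lie in the same part. -/
theorem isC4Saturated_hubGraph {p : V → ℕ} (hft : ∀ i, f (t i) = i) (hσ : ∀ v, σ (σ v) = v)
    (hσt : ∀ i, σ (t i) = t i) (hfσ : ∀ v, f (σ v) = f v)
    (hpt : ∀ i j, i ≠ j → p (t i) ≠ p (t j)) (hpf : ∀ v, v ≠ t (f v) → p v ≠ p (t (f v)))
    (hpσ : ∀ v, σ v ≠ v → p (σ v) ≠ p v)
    (hleaf : ∀ u v, f u = f v → u ≠ t (f u) → v ≠ t (f v) → σ u = u → σ v = v → p u = p v) :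
    IsC4Saturated (hubGraph t f σ) p := by
  have hσhub : ∀ v, v ≠ t (f v) → σ v ≠ t (f (σ v)) := fun v hv e => hv (by
    have := congrArg σ e
    rwa [hσ, hσt, hfσ] at this)
  refine ⟨fun u v huv => ?_, fun u v hp hn => ?_, fun a c hac b d hab hcb had hcd => ?_⟩
  · rcases huv.2 with h | h | h | h
    · rw [h.1, h.2]
      exact hpt _ _ fun e => huv.1 (by rw [h.1, h.2, e])
    · rcases h.2 with h' | h'
      · have hv : v ≠ t (f v) := fun e => huv.1 (by rw [h', e, h.1])
        have := hpf v hv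
        rw [← h.1, ← h'] at this
        exact this.symm
      · have hu : u ≠ t (f u) := fun e => huv.1 (by rw [h', e, h.1])
        have := hpf u hu
        rwa [h.1, ← h'] at this
    · rw [h]
      exact (hpσ u fun e => huv.1 (by rw [h, e])).symm
    · rw [h]
      exact hpσ v fun e => huv.1 (by rw [h, e])
  · have huv : u ≠ v := fun e => hp (e ▸ rfl)
    by_cases hf : f u = f v
    · -- attached to the same hub: one of the two lies in a triangle with the hub
      have hu : u ≠ t (f u) := fun e => hn ⟨huv, Or.inr (Or.inl ⟨hf, Or.inl e⟩)⟩
      have hv : v ≠ t (f v) := fun e => hn ⟨huv, Or.inr (Or.inl ⟨hf, Or.inr e⟩)⟩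
      by_cases hσu : σ u = u
      · have hσv : σ v ≠ v := fun e => hp (hleaf u v hf hu hv hσu e)
        refine ⟨t (f u), σ v, hubGraph_adj_hub hu hft, ?_, hσv, Or.inr (Or.inr (Or.inr rfl))⟩
        rw [hf, ← hfσ v]
        exact (hubGraph_adj_hub (hσhub v hv) hft).symm
      · refine ⟨σ u, t (f v), ⟨fun e => hσu e.symm, Or.inr (Or.inr (Or.inl rfl))⟩, ?_,
          (hubGraph_adj_hub hv hft).symm⟩
        rw [← hf, ← hfσ u]
        exact hubGraph_adj_hub (hσhub u hu) hft
    · -- attached to different hubs, possibly detouring through the third one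
      obtain ⟨l, hlu, hlv⟩ : ∃ l : Fin 3, l ≠ f u ∧ l ≠ f v := by
        generalize f u = i
        generalize f v = j
        revert i j
        decide
      by_cases hu : u = t (f u)
      · by_cases hv : v = t (f v)
        · exact absurd ⟨huv, Or.inl ⟨hu, hv⟩⟩ hn
        · refine ⟨t l, t (f v), ?_, hubGraph_adj_hub_hub hlv hft, (hubGraph_adj_hub hv hft).symm⟩
          rw [hu]
          exact hubGraph_adj_hub_hub hlu.symm hft
      · by_cases hv : v = t (f v)
        · refine ⟨t (f u), t l, hubGraph_adj_hub hu hft, hubGraph_adj_hub_hub hlu.symm hft, ?_⟩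
          rw [hv]
          exact hubGraph_adj_hub_hub hlv hft
        · exact ⟨t (f u), t (f v), hubGraph_adj_hub hu hft, hubGraph_adj_hub_hub hf hft,
            (hubGraph_adj_hub hv hft).symm⟩
  · by_contra hbd
    have nonhub : ∀ a c b d : V, a ≠ c → b ≠ d → (hubGraph t f σ).Adj a b →
        (hubGraph t f σ).Adj c b → (hubGraph t f σ).Adj a d → (hubGraph t f σ).Adj c d →
        a = t (f a) := by
      intro a c b d hac hbd hab hcb had hcd
      by_contra ha
      have aux : ∀ b d, (hubGraph t f σ).Adj c b → (hubGraph t f σ).Adj c d → b = t (f a) →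
          d = σ a → False := by
        rintro b d hcb hcd rfl rfl
        rcases hubGraph_eq_or_eq_of_adj hσ (hσhub a ha) hcd.symm with e | e
        · rw [hfσ] at e
          exact hcb.1 e
        · rw [hσ] at e
          exact hac e.symm
      rcases hubGraph_eq_or_eq_of_adj hσ ha hab with e1 | e1 <;>
        rcases hubGraph_eq_or_eq_of_adj hσ ha had with e2 | e2
      · exact hbd (e1.trans e2.symm)
      · exact aux b d hcb hcd e1 e2
      · exact aux d b hcd hcb e2 e1
      · exact hbd (e1.trans e2.symm)
    have ha := nonhub a c b d hac hbd hab hcb had hcd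
    have hc := nonhub c a b d hac.symm hbd hcb hab hcd had
    have hb := nonhub b d a c hbd hac hab.symm had.symm hcb.symm hcd.symm
    have hd := nonhub d b a c (Ne.symm hbd) hac had.symm hab.symm hcd.symm hcb.symm
    have ne : ∀ x y, x = t (f x) → y = t (f y) → x ≠ y → f x ≠ f y := fun x y hx hy hxy e =>
      hxy (by rw [hx, hy, e])
    have four : ∀ i j k l : Fin 3, i ≠ j → i ≠ k → i ≠ l → j ≠ k → j ≠ l → k = l := by
      decide
    exact ne _ _ hc hd hcd.1 (four (f a) (f b) (f c) (f d) (ne _ _ ha hb hab.1) (ne _ _ ha hc hac)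
      (ne _ _ ha hd had.1) (ne _ _ hb hc hcb.1.symm) (ne _ _ hb hd hbd))

theorem sum_degree_hubGraph_le [Fintype V] [DecidableEq V] [DecidableRel (hubGraph t f σ).Adj]
    (hft : ∀ i, f (t i) = i) (hσ : ∀ v, σ (σ v) = v) (hσt : ∀ i, σ (t i) = t i) :
    ∑ v, (hubGraph t f σ).degree v ≤ 2 * Fintype.card V + #{v | σ v ≠ v} := by
  have htinj : Function.Injective t := fun i j e => by rw [← hft i, ← hft j, e]
  set Q : Finset V := univ.image t with hQ
  have hQmem : ∀ v, v ∈ Q ↔ v = t (f v) := fun v => by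
    rw [hQ, mem_image]
    constructor
    · rintro ⟨i, -, rfl⟩
      rw [hft]
    · exact fun e => ⟨f v, mem_univ _, e.symm⟩
  have hQcard : #Q = 3 := by rw [hQ, card_image_of_injective _ htinj]; rfl
  have h1 : ∀ v ∈ Qᶜ, (hubGraph t f σ).degree v ≤ 1 + if σ v ≠ v then 1 else 0 := by
    intro v hv
    rw [mem_compl, hQmem] at hv
    have hsub : (hubGraph t f σ).neighborFinset v ⊆
        insert (t (f v)) (({σ v} : Finset V).filter fun w => w ≠ v) := by
      intro w hw
      rw [SimpleGraph.mem_neighborFinset] at hw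
      rw [mem_insert, mem_filter, mem_singleton]
      exact (hubGraph_eq_or_eq_of_adj hσ hv hw).imp id fun e => ⟨e, hw.1.symm⟩
    refine (card_le_card hsub).trans ((card_insert_le _ _).trans ?_)
    rw [filter_singleton]
    split_ifs <;> simp
  have h2 : ∀ v ∈ Q, (hubGraph t f σ).degree v ≤ 2 + #(Qᶜ.filter fun w => f w = f v) := by
    intro v hv
    have hv' := (hQmem v).1 hv
    have hsub : (hubGraph t f σ).neighborFinset v ⊆
        Q.erase v ∪ Qᶜ.filter fun w => f w = f v := by
      intro w hw
      rw [SimpleGraph.mem_neighborFinset] at hw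
      rw [mem_union, mem_erase, mem_filter, mem_compl]
      by_cases hwQ : w ∈ Q
      · exact Or.inl ⟨hw.1.symm, hwQ⟩
      · refine Or.inr ⟨hwQ, ?_⟩
        rw [hQmem] at hwQ
        rcases hubGraph_eq_or_eq_of_adj hσ hwQ hw.symm with e | e
        · rw [e, hft]
        · -- the partner of a hub is the hub itself
          have := congrArg σ e
          rw [hσ, hv', hσt, ← hv'] at this
          exact absurd this hw.1
    refine (card_le_card hsub).trans ((card_union_le _ _).trans ?_)
    rw [card_erase_of_mem hv, hQcard]
  have h3 : ∑ v ∈ Q, #(Qᶜ.filter fun w => f w = f v) = #Qᶜ := by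
    rw [hQ, sum_image fun i _ j _ e => htinj e, ← hQ]
    simp only [hft]
    exact (card_eq_sum_card_fiberwise fun _ _ => mem_univ _).symm
  have h4 : #(Qᶜ.filter fun v => σ v ≠ v) ≤ #{v | σ v ≠ v} :=
    card_le_card (filter_subset_filter _ (subset_univ _))
  have h5 := sum_le_sum h1
  have h6 := sum_le_sum h2
  rw [sum_add_distrib, ← card_filter, sum_const, smul_eq_mul] at h5
  rw [sum_add_distrib, sum_const, smul_eq_mul, h3, hQcard] at h6
  have h7 := sum_add_sum_compl Q fun v => (hubGraph t f σ).degree v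
  have h8 := card_add_card_compl Q
  omega

end HubGraph

/-! ### Matching a balanced family of colour classes -/

/-- If no colour class takes up more than half of `R`, then `R` can be paired off with different
colours in each pair: list `R` by colour and pair each element with the one half the list away. -/
theorem exists_involution_of_balanced {V : Type*} [DecidableEq V] (R : Finset V) (c : V → ℕ)
    (m : ℕ) (hR : #R = 2 * m) (hc : ∀ i, #(R.filter fun v => c v = i) ≤ m) :
    ∃ σ : V → V, (∀ v, σ (σ v) = v) ∧ (∀ v ∈ R, σ v ∈ R ∧ c (σ v) ≠ c v) ∧
      ∀ v ∉ R, σ v = v := by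
  obtain ⟨e, he⟩ : ∃ e : Fin (2 * m) ≃ R, Monotone fun i => c (e i) := by
    let e₀ : Fin (2 * m) ≃ R := (R.equivFinOfCardEq hR).symm
    exact ⟨(Tuple.sort fun i => c (e₀ i)).trans e₀, Tuple.monotone_sort fun i => c (e₀ i)⟩
  have hne : ∀ i j : Fin (2 * m), (j : ℕ) = i + m → c (e i) ≠ c (e j) := by
    intro i j hij hcol
    have hsub : ((Finset.Icc i j).image fun l => (e l : V)) ⊆
        R.filter fun v => c v = c (e i) := by
      intro v hv
      obtain ⟨l, hl, rfl⟩ := mem_image.1 hv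
      rw [Finset.mem_Icc] at hl
      exact mem_filter.2 ⟨(e l).2, le_antisymm ((he hl.2).trans hcol.ge) (he hl.1)⟩
    have h1 := (card_le_card hsub).trans (hc _)
    rw [card_image_of_injective _ fun x y hxy => e.injective (Subtype.ext hxy), Fin.card_Icc] at h1
    omega
  let τ : Fin (2 * m) → Fin (2 * m) := fun i =>
    if h : (i : ℕ) < m then ⟨i + m, by omega⟩ else ⟨i - m, by omega⟩
  have hτ : ∀ i, τ (τ i) = i := by
    intro i
    by_cases h : (i : ℕ) < m
    · ext
      simp [τ, h]
    · have : (i : ℕ) - m < m := by omega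
      ext
      simp only [τ, h, this, dite_true, dite_false]
      omega
  have hτc : ∀ i, c (e (τ i)) ≠ c (e i) := by
    intro i
    by_cases h : (i : ℕ) < m
    · exact (hne i (τ i) (by simp [τ, h])).symm
    · exact hne (τ i) i (by simp only [τ, h, dite_false]; omega)
  refine ⟨fun v => if h : v ∈ R then e (τ (e.symm ⟨v, h⟩)) else v, fun v => ?_, fun v hv => ?_,
    fun v hv => by simp [hv]⟩
  · by_cases hv : v ∈ R
    · simp [hv, hτ]
    · simp [hv]
  · refine ⟨by simp [hv], ?_⟩
    have := hτc (e.symm ⟨v, hv⟩)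
    simpa [hv] using this

/-! ### Saturated graphs in the complete equipartite graph -/

/-- A number less than three that differs from `i` and `j`. -/
def thirdHub (i j : ℕ) : Fin 3 :=
  if i ≠ 0 ∧ j ≠ 0 then 0 else if i ≠ 1 ∧ j ≠ 1 then 1 else 2

theorem thirdHub_comm (i j : ℕ) : thirdHub i j = thirdHub j i := by
  simp only [thirdHub, and_comm]

theorem ne_thirdHub (i j : ℕ) : i ≠ thirdHub i j := by
  unfold thirdHub
  split_ifs with h1 h2
  · exact h1.1
  · exact h2.1
  · rintro rfl
    simp at h1 h2
    omega

theorem card_fiber_equipartite (k n : ℕ) (v : Fin k × Fin n) :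
    #{w : Fin k × Fin n | (w.1 : ℕ) = v.1} = n := by
  have : ({w : Fin k × Fin n | (w.1 : ℕ) = v.1} : Finset (Fin k × Fin n)) =
      ({v.1} : Finset (Fin k)) ×ˢ univ := by
    ext w
    rw [mem_filter, mem_product, mem_singleton, Fin.ext_iff]
    simp
  rw [this, card_product]
  simp

theorem two_mul_ncard_edgeSet {V : Type*} [Fintype V] (H : SimpleGraph V) [DecidableRel H.Adj] :
    2 * H.edgeSet.ncard = ∑ v, H.degree v := by
  rw [SimpleGraph.sum_degrees_eq_twice_card_edges, ← SimpleGraph.coe_edgeFinset,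
    Set.ncard_coe_finset]

/-- The number of vertices in part `i` that are neither leaves nor hubs, if `lab` assigns hubs to
the parts consisting of leaves and there is one hub in each of the parts `0`, `1`, `2`. -/
def numMatched (lab : ℕ → Option (Fin 3)) (n i : ℕ) : ℕ :=
  if lab i = none then (if i < 3 then n - 1 else n) else 0

/-- The label `lab i = some x` says that the vertices of part `i`, its hub excepted, are leaves at
the hub of part `x`. -/
theorem exists_saturated_of_label {k n m : ℕ} (hk : 3 ≤ k) (hn : 1 ≤ n)
    (lab : ℕ → Option (Fin 3)) (hlab : ∀ i x, lab i = some x → i ≠ x)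
    (hinj : ∀ i j x, lab i = some x → lab j = some x → i = j)
    (hm : ∑ i ∈ range k, numMatched lab n i = 2 * m) (hle : ∀ i < k, numMatched lab n i ≤ m) :
    ∃ H : SimpleGraph (Fin k × Fin n),
      IsSaturatedRel (SimpleGraph.completeEquipartiteGraph k n) (SimpleGraph.cycleGraph 4) H ∧
        H.edgeSet.ncard ≤ k * n + m := by
  classical
  let c : Fin k × Fin n → ℕ := fun v => v.1
  let t : Fin 3 → Fin k × Fin n := fun i => (⟨i, by omega⟩, ⟨0, hn⟩)
  let hub : Fin k × Fin n → Prop := fun v => (v.1 : ℕ) < 3 ∧ (v.2 : ℕ) = 0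
  let R : Finset (Fin k × Fin n) := univ.filter fun v => lab v.1 = none ∧ ¬ hub v
  have hmem : ∀ v, v ∈ R ↔ lab v.1 = none ∧ ¬ hub v := fun v => by simp [R]
  have hrow : ∀ i : Fin k, (∑ j : Fin n, if lab i = none ∧ ¬ hub (i, j) then 1 else 0) =
      numMatched lab n i := by
    intro i
    unfold numMatched
    by_cases h1 : lab i = none
    · by_cases h2 : (i : ℕ) < 3
      · simp only [h1, h2, hub, true_and, if_true]
        rw [← card_filter]
        have : (univ.filter fun j : Fin n => ¬ (j : ℕ) = 0) = univ.erase ⟨0, hn⟩ := by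
          ext j
          simp [Fin.ext_iff]
        rw [this, card_erase_of_mem (mem_univ _), card_univ, Fintype.card_fin]
      · simp [h1, h2, hub]
    · simp [h1]
  have hRcard : #R = 2 * m := by
    rw [← hm, card_filter, Fintype.sum_prod_type, ← Fin.sum_univ_eq_sum_range]
    exact sum_congr rfl fun i _ => hrow i
  have hRle : ∀ i, #(R.filter fun v => c v = i) ≤ m := by
    intro i
    by_cases hi : i < k
    · refine le_trans (le_of_eq ?_) (hle i hi)
      rw [← hrow ⟨i, hi⟩, ← card_filter]
      refine card_bij' (fun v _ => v.2) (fun j _ => (⟨i, hi⟩, j)) ?_ ?_ ?_ ?_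
      · rintro ⟨v, j⟩ hv
        rw [mem_filter, hmem] at hv
        obtain ⟨hv, rfl⟩ := hv
        simpa using hv
      · intro j hj
        rw [mem_filter, hmem]
        exact ⟨(mem_filter.1 hj).2, rfl⟩
      · rintro ⟨v, j⟩ hv
        obtain rfl := (mem_filter.1 hv).2
        rfl
      · exact fun _ _ => rfl
    · rw [filter_false_of_mem]
      · simp
      · rintro v - rfl
        exact hi v.1.2
  obtain ⟨σ, hσ, hσR, hσn⟩ := exists_involution_of_balanced R c m hRcard hRle
  let f : Fin k × Fin n → Fin 3 := fun v =>
    if h : hub v then ⟨v.1, h.1⟩ else (lab v.1).getD (thirdHub v.1 (σ v).1)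
  have hubt : ∀ i, hub (t i) := fun i => ⟨i.2, rfl⟩
  have hft : ∀ i, f (t i) = i := fun i => by
    simp only [f, dif_pos (hubt i)]
    rfl
  have hfR : ∀ v ∈ R, f v = thirdHub v.1 (σ v).1 := fun v hv => by
    have := (hmem v).1 hv
    simp [f, this.1, this.2]
  have hhub : ∀ v, v = t (f v) ↔ hub v := by
    refine fun v => ⟨fun e => e ▸ hubt (f v), fun h => ?_⟩
    simp only [f, dif_pos h]
    exact Prod.ext rfl (Fin.ext h.2)
  -- a vertex that is neither matched nor a hub carries a label
  have hflab : ∀ v, v ∉ R → ¬ hub v → lab v.1 = some (f v) := by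
    intro v hv hh
    have : lab v.1 ≠ none := fun e => hv ((hmem v).2 ⟨e, hh⟩)
    obtain ⟨x, hx⟩ := Option.ne_none_iff_exists'.1 this
    simp [f, hh, hx]
  have hσfix : ∀ v, σ v = v → v ∉ R := fun v e hv => (hσR v hv).2 (by rw [e])
  have hσt : ∀ i, σ (t i) = t i := fun i => hσn _ fun hh => ((hmem _).1 hh).2 (hubt i)
  have hsat : IsC4Saturated (hubGraph t f σ) c := by
    refine isC4Saturated_hubGraph hft hσ hσt ?_ ?_ ?_ ?_ ?_
    · intro v
      by_cases hv : v ∈ R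
      · rw [hfR v hv, hfR _ (hσR v hv).1, hσ, thirdHub_comm]
      · rw [hσn v hv]
    · exact fun i j hij e => hij (Fin.ext e)
    · intro v hv
      by_cases hvR : v ∈ R
      · rw [hfR v hvR]
        exact ne_thirdHub _ _
      · exact hlab _ _ (hflab v hvR fun e => hv ((hhub v).2 e))
    · intro v hv
      by_cases hvR : v ∈ R
      · exact (hσR v hvR).2
      · exact absurd (hσn v hvR) hv
    · intro u v hf hu hv hσu hσv
      refine hinj _ _ (f v) ?_ (hflab v (hσfix v hσv) fun e => hv ((hhub v).2 e))
      rw [← hf]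
      exact hflab u (hσfix u hσu) fun e => hu ((hhub u).2 e)
  refine ⟨hubGraph t f σ, (isSaturatedRel_cycleGraph_four_iff _ _ c fun u v => ?_).2 hsat, ?_⟩
  · rw [SimpleGraph.completeEquipartiteGraph_adj, Ne, Ne, Fin.ext_iff]
  · have h1 := sum_degree_hubGraph_le hft hσ hσt (f := f)
    have h2 : #{v | σ v ≠ v} ≤ #R := card_le_card fun v hv => by
      by_contra hvR
      exact (mem_filter.1 hv).2 (hσn v hvR)
    rw [← two_mul_ncard_edgeSet, Fintype.card_prod, Fintype.card_fin, Fintype.card_fin] at h1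
    omega

/-- The leaves are parts `3` and `4` and, except for its hub, part `0`, so `3n - 1` in all, and an even
number of vertices remains to be matched. -/
theorem exists_saturated_three_mul_sub_two {k n : ℕ} (hk : 5 ≤ k) (hn : 1 ≤ n)
    (hpar : Even ((k - 1) * n)) : ∃ H : SimpleGraph (Fin k × Fin n),
      IsSaturatedRel (SimpleGraph.completeEquipartiteGraph k n) (SimpleGraph.cycleGraph 4) H ∧
        2 * H.edgeSet.ncard + 2 ≤ 3 * (k - 1) * n := by
  obtain ⟨l, rfl⟩ := Nat.exists_eq_add_of_le' hk
  obtain ⟨r, rfl⟩ := Nat.exists_eq_add_of_le' hn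
  have hpar' : Even (l * (r + 1)) := by
    have e : (l + 5 - 1) * (r + 1) = l * (r + 1) + 4 * (r + 1) := by
      rw [show l + 5 - 1 = l + 4 by omega]; ring
    rw [e, Nat.even_add] at hpar
    exact hpar.2 (Nat.even_mul.2 (Or.inl (by decide)))
  obtain ⟨q, hq⟩ := hpar'
  let lab : ℕ → Option (Fin 3) := fun i =>
    if i = 3 then some 0 else if i = 4 then some 1 else if i = 0 then some 2 else none
  have hsome : ∀ i x, lab i = some x ↔ (i = 3 ∧ x = 0) ∨ (i = 4 ∧ x = 1) ∨ (i = 0 ∧ x = 2) := by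
    intro i x
    simp only [lab]
    split_ifs with h1 h2 h3 <;> simp [*, eq_comm]
  -- `q + r` is half of the number `(k - 3) n - 2` of matched vertices
  obtain ⟨H, hH, hc⟩ := exists_saturated_of_label (k := l + 5) (n := r + 1) (m := q + r)
    (by omega) (by omega) lab
    (fun i x h => by
      rcases (hsome i x).1 h with ⟨rfl, rfl⟩ | ⟨rfl, rfl⟩ | ⟨rfl, rfl⟩ <;> simp)
    (fun i j x hi hj => by
      rcases (hsome i x).1 hi with ⟨rfl, rfl⟩ | ⟨rfl, rfl⟩ | ⟨rfl, rfl⟩ <;>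
        exact (show j = _ by simpa using (hsome j _).1 hj).symm)
    (by
      have hlt : ∀ x, ¬ x + 1 + 1 + 1 + 1 + 1 < 3 := fun x => by omega
      simp [sum_range_succ', numMatched, lab, hlt]
      omega)
    (by
      intro i hi
      have hbig : i < 5 ∨ r + 1 ≤ q + r := by
        by_contra! hcon
        have : 1 ≤ l := by omega
        have : 1 * (r + 1) ≤ l * (r + 1) := Nat.mul_le_mul_right _ this
        omega
      unfold numMatched
      simp only [lab]
      split_ifs <;> first | omega | simp_all)
  refine ⟨H, hH, ?_⟩
  rw [show l + 5 - 1 = l + 4 by omega]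
  nlinarith

/-- The leaves are the parts `3`, `4` and `5`, so `3n` in all, and `(k - 3) n - 3`, an even number,
of vertices remain to be matched. -/
theorem exists_saturated_three_mul_sub_three {k n : ℕ} (hk : 6 ≤ k) (hn : 1 ≤ n)
    (hke : Even k) (hno : Odd n) : ∃ H : SimpleGraph (Fin k × Fin n),
      IsSaturatedRel (SimpleGraph.completeEquipartiteGraph k n) (SimpleGraph.cycleGraph 4) H ∧
        2 * H.edgeSet.ncard + 3 ≤ 3 * (k - 1) * n := by
  obtain ⟨l, rfl⟩ := Nat.exists_eq_add_of_le' hk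
  obtain ⟨r, rfl⟩ := hno
  obtain ⟨q, hq⟩ : Even l := (Nat.even_add.1 hke).2 (by decide)
  let lab : ℕ → Option (Fin 3) := fun i =>
    if i = 3 then some 0 else if i = 4 then some 1 else if i = 5 then some 2 else none
  have hsome : ∀ i x, lab i = some x ↔ (i = 3 ∧ x = 0) ∨ (i = 4 ∧ x = 1) ∨ (i = 5 ∧ x = 2) := by
    intro i x
    simp only [lab]
    split_ifs with h1 h2 h3 <;> simp [*, eq_comm]
  -- `m` is half of the number `(k - 3) n - 3` of matched vertices
  obtain ⟨H, hH, hc⟩ := exists_saturated_of_label (k := l + 6) (n := 2 * r + 1)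
    (m := q * (2 * r + 1) + 3 * r) (by omega) (by omega) lab
    (fun i x h => by
      rcases (hsome i x).1 h with ⟨rfl, rfl⟩ | ⟨rfl, rfl⟩ | ⟨rfl, rfl⟩ <;> simp)
    (fun i j x hi hj => by
      rcases (hsome i x).1 hi with ⟨rfl, rfl⟩ | ⟨rfl, rfl⟩ | ⟨rfl, rfl⟩ <;>
        exact (show j = _ by simpa using (hsome j _).1 hj).symm)
    (by
      have hlt : ∀ x, ¬ x + 1 + 1 + 1 + 1 + 1 + 1 < 3 := fun x => by omega
      simp [sum_range_succ', numMatched, lab, hlt, hq]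
      ring)
    (by
      intro i hi
      have hbig : i < 6 ∨ 2 * r + 1 ≤ q * (2 * r + 1) := by
        by_contra! hcon
        have : 1 ≤ q := by omega
        have : 1 * (2 * r + 1) ≤ q * (2 * r + 1) := Nat.mul_le_mul_right _ this
        omega
      unfold numMatched
      simp only [lab]
      split_ifs <;> first | omega | simp_all)
  refine ⟨H, hH, ?_⟩
  subst hq
  rw [show q + q + 6 - 1 = q + q + 5 by omega]
  nlinarith

/-- The leaves are part `3` and, except for its hub, part `0`. The remaining vertices of
parts `1` and `2` are matched with each other. -/
theorem exists_saturated_four {n : ℕ} (hn : 1 ≤ n) : ∃ H : SimpleGraph (Fin 4 × Fin n),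
      IsSaturatedRel (SimpleGraph.completeEquipartiteGraph 4 n) (SimpleGraph.cycleGraph 4) H ∧
        H.edgeSet.ncard + 1 ≤ 5 * n := by
  let lab : ℕ → Option (Fin 3) := fun i =>
    if i = 3 then some 0 else if i = 0 then some 1 else none
  have hsome : ∀ i x, lab i = some x ↔ (i = 3 ∧ x = 0) ∨ (i = 0 ∧ x = 1) := by
    intro i x
    simp only [lab]
    split_ifs with h1 h2 <;> simp [*, eq_comm]
  obtain ⟨H, hH, hc⟩ := exists_saturated_of_label (k := 4) (n := n) (m := n - 1)
    (by omega) hn lab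
    (fun i x h => by
      rcases (hsome i x).1 h with ⟨rfl, rfl⟩ | ⟨rfl, rfl⟩ <;> simp)
    (fun i j x hi hj => by
      rcases (hsome i x).1 hi with ⟨rfl, rfl⟩ | ⟨rfl, rfl⟩ <;>
        exact (show j = _ by simpa using (hsome j _).1 hj).symm)
    (by
      simp [sum_range_succ', numMatched, lab]
      omega)
    (by
      intro i hi
      unfold numMatched
      simp only [lab]
      split_ifs <;> first | omega | simp_all)
  exact ⟨H, hH, by omega⟩

theorem three_mul_le_of_isSaturatedRel {k n : ℕ} (hk : 2 ≤ k) {H : SimpleGraph (Fin k × Fin n)}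
    (hH : IsSaturatedRel (SimpleGraph.completeEquipartiteGraph k n) (SimpleGraph.cycleGraph 4) H) :
    3 * (k - 1) * n ≤ 2 * H.edgeSet.ncard + 3 := by
  classical
  have h := (isSaturatedRel_cycleGraph_four_iff _ _ (fun v => (v.1 : ℕ)) fun u v => by
    rw [SimpleGraph.completeEquipartiteGraph_adj, Ne, Ne, Fin.ext_iff]).1 hH
  have := h.three_mul_card_le (card_fiber_equipartite k n) fun u => by
    by_cases hu : (u.1 : ℕ) = 0
    · exact ⟨(⟨1, by omega⟩, u.2), by simp [hu]⟩
    · exact ⟨(⟨0, by omega⟩, u.2), hu⟩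
  rw [← two_mul_ncard_edgeSet, Fintype.card_prod, Fintype.card_fin, Fintype.card_fin] at this
  obtain ⟨l, rfl⟩ := Nat.exists_eq_add_of_le' hk
  rw [show l + 2 - 1 = l + 1 by omega]
  nlinarith

theorem satNumber_le {V W : Type*} {G H : SimpleGraph V} {F : SimpleGraph W}
    (hH : IsSaturatedRel G F H) : satNumber G F ≤ H.edgeSet.ncard :=
  Nat.sInf_le ⟨H, hH, rfl⟩

theorem exists_ncard_edgeSet_eq_satNumber {V W : Type*} {G H : SimpleGraph V} {F : SimpleGraph W}
    (hH : IsSaturatedRel G F H) :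
    ∃ H' : SimpleGraph V, IsSaturatedRel G F H' ∧ H'.edgeSet.ncard = satNumber G F :=
  Nat.sInf_mem (s := {m | ∃ H : SimpleGraph V, IsSaturatedRel G F H ∧ H.edgeSet.ncard = m})
    ⟨_, H, hH, rfl⟩

theorem three_mul_le_satPartiteCycle {k n : ℕ} (hk : 2 ≤ k) {H : SimpleGraph (Fin k × Fin n)}
    (hH : IsSaturatedRel (SimpleGraph.completeEquipartiteGraph k n) (SimpleGraph.cycleGraph 4) H) :
    3 * (k - 1) * n ≤ 2 * satPartiteCycle k n 4 + 3 := by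
  obtain ⟨H', hH', he⟩ := exists_ncard_edgeSet_eq_satNumber hH
  rw [satPartiteCycle, ← he]
  exact three_mul_le_of_isSaturatedRel hk hH'

/-- The value is determined by the bounds and the parity of `3 (k - 1) n`. -/
theorem two_mul_satPartiteCycle {k n : ℕ} (hk : 5 ≤ k) (hn : 1 ≤ n) :
    (Even k ∧ Odd n → 2 * satPartiteCycle k n 4 + 3 = 3 * (k - 1) * n) ∧
    (¬ (Even k ∧ Odd n) → 2 * satPartiteCycle k n 4 + 2 = 3 * (k - 1) * n) := by
  constructor
  · rintro ⟨hke, hno⟩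
    have hk6 : 6 ≤ k := by
      rcases hke with ⟨r, rfl⟩
      omega
    obtain ⟨H, hH, hc⟩ := exists_saturated_three_mul_sub_three hk6 hn hke hno
    have h1 := three_mul_le_satPartiteCycle (by omega) hH
    have h2 : satPartiteCycle k n 4 ≤ _ := satNumber_le hH
    omega
  · intro hpar
    have heven : Even ((k - 1) * n) := by
      rw [Nat.even_mul]
      by_cases hke : Even k
      · exact Or.inr (Nat.not_odd_iff_even.1 fun e => hpar ⟨hke, e⟩)
      · left
        rw [Nat.not_even_iff_odd] at hke
        obtain ⟨r, rfl⟩ := hke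
        simp
    obtain ⟨H, hH, hc⟩ := exists_saturated_three_mul_sub_two hk hn heven
    have h1 := three_mul_le_satPartiteCycle (by omega) hH
    have h2 : satPartiteCycle k n 4 ≤ _ := satNumber_le hH
    obtain ⟨q, hq⟩ := heven
    rw [mul_assoc, hq] at hc h1 ⊢
    omega

theorem theorem1p9 :
    (∀ k n : ℕ, 5 ≤ k → 1 ≤ n →
      (satPartiteCycle k n 4 : ℤ) = ⌊(3 * ((k : ℝ) - 1) * (n : ℝ) - 2) / 2⌋ ∧
      (Even k ∧ Odd n →
        (satPartiteCycle k n 4 : ℝ) = 3 / 2 * ((k : ℝ) - 1) * (n : ℝ) - 3 / 2) ∧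
      (¬ (Even k ∧ Odd n) →
        (satPartiteCycle k n 4 : ℝ) = 3 / 2 * ((k : ℝ) - 1) * (n : ℝ) - 1)) ∧
    (∀ n : ℕ, 1 ≤ n →
      ⌊9 / 2 * (n : ℝ) - 1⌋ ≤ (satPartiteCycle 4 n 4 : ℤ) ∧
      (satPartiteCycle 4 n 4 : ℤ) ≤ 5 * (n : ℤ) - 1) := by
  refine ⟨fun k n hk hn => ?_, fun n hn => ?_⟩
  · obtain ⟨hodd, heven⟩ := two_mul_satPartiteCycle hk hn
    have hcast : ((3 * (k - 1) * n : ℕ) : ℝ) = 3 * ((k : ℝ) - 1) * n := by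
      rw [Nat.cast_mul, Nat.cast_mul, Nat.cast_sub (by omega)]
      norm_num
    have hodd' : Even k ∧ Odd n →
        2 * (satPartiteCycle k n 4 : ℝ) + 3 = 3 * ((k : ℝ) - 1) * n := fun h => by
      rw [← hcast, ← hodd h]
      push_cast
      ring
    have heven' : ¬ (Even k ∧ Odd n) →
        2 * (satPartiteCycle k n 4 : ℝ) + 2 = 3 * ((k : ℝ) - 1) * n := fun h => by
      rw [← hcast, ← heven h]
      push_cast
      ring
    refine ⟨?_, fun h => by linarith [hodd' h], fun h => by linarith [heven' h]⟩
    symm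
    rw [Int.floor_eq_iff, Int.cast_natCast]
    by_cases h : Even k ∧ Odd n
    · constructor <;> linarith [hodd' h]
    · constructor <;> linarith [heven' h]
  · obtain ⟨H, hH, hc⟩ := exists_saturated_four hn
    have h1 := three_mul_le_satPartiteCycle (by omega) hH
    have h2 : satPartiteCycle 4 n 4 ≤ _ := satNumber_le hH
    refine ⟨?_, by omega⟩
    rw [← Int.lt_add_one_iff, Int.floor_lt]
    have h3 : (9 * n : ℝ) ≤ 2 * satPartiteCycle 4 n 4 + 3 := by exact_mod_cast h1
    push_cast
    linarith
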